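/- Let $\mathcal H$ be a complex Hilbert space with orthonormal basis $(|n\rangle)_{n\in\mathbb N}$ (number states), let $N|n\rangle=n|n\rangle$, and let $|z\rangle=e^{-|z|^2/2}\sum_{n\ge0}\frac{z^n}{\sqrt{n!}}|n\rangle$, $|z_1,z_2\rangle=|z_1\rangle\otimes|z_2\rangle\in\mathcal H\otimes\mathcal H$ be the coherent states. Inner products are linear in the second argument. Identify the phase interval $[0,2\pi)$, with addition modulo $2\pi$, with the circle $\mathbb R/2\pi\mathbb Z$. A phase observable is a normalized positive operator measure $E:\mathcal B([0,2\pi))\to\mathcal L(\mathcal H)$ (σ-additive in the weak operator topology) with $e^{i\theta N}E(X)e^{-i\theta N}=E(X+\theta)$ for all Borel sets $X$ and all $\theta\in\mathbb R$. Its phase matrix $(c_{n,m})$ is given by $E(X)=\sum_{n,m}c_{n,m}\frac1{2\pi}\int_Xe^{i(n-m)\theta}\,d\theta\,|n\rangle\langle m|$. Let $E_1,E_2$ be phase observables with phase matrices $(c^1_{n,m})$ and $(c^2_{n,m})$. There is a unique normalized positive operator measure $\tilde E:\mathcal B([0,2\pi)\times[0,2\pi))\to\mathcal L(\mathcal H\otimes\mathcal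 H)$ with $\tilde E(X\times Y)=E_1(X)\otimes E_2(Y)$ for all Borel sets $X,Y$. Let $E^{\rm diff}(X)=\tilde E(\{(x,y): x-y \bmod 2\pi\in X\})$ be the difference of $E_1$ and $E_2$. Let $\alpha\in\mathbb R$ and suppose that $\lim_{n\to\infty}c^2_{n,n+k}=e^{-ik\alpha}$ for all integers $k\ge1$. (a) For every Borel set $X$, every $z_1\in\mathbb C$ and every $\eta\in\mathbb R$, with $z_2=re^{i\eta}$ (so that $\arg z_2=\eta$ modulo $2\pi$ is fixed), $$\lim_{r\to\infty}\langle z_1,z_2|E^{\rm diff}(X)|z_1,z_2\rangle=\langle z_1|E_1(X+\eta-\alpha)|z_1\rangle .$$ (b) Suppose moreover that $\alpha'\in\mathbb R$ and $\lim_{n\to\infty}c^1_{n,n+k}=e^{-ik\alpha'}$ for all integers $k\ge1$. Let $\eta_1,\eta_2\in\mathbb R$, $z_1=r_1e^{i\eta_1}$, $z_2=r_2e^{i\eta_2}$, and let $p=\eta_1-\eta_2-\alpha'+\alpha$ modulo $2\pi$. As $r_1\to\infty$ and $r_2\to\infty$ jointly, the probability measures $X\mapsto\langle z_1,z_2|E^{\rm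 diff}(X)|z_1,z_2\rangle$ converge weakly, as measures on the circle, to the Dirac measure $\delta_p$; that is, their integrals of every continuous function $g$ on the circle converge to $g(p)$. In particular, $\langle z_1,z_2|E^{\rm diff}(X)|z_1,z_2\rangle\to\delta_p(X)$ for every Borel set $X$ whose boundary in the circle does not contain $p$. -/

import Mathlib

open MeasureTheory Filter Topology TensorProduct

noncomputable section

namespace QuantumPhase

instance two_pi_pos_fact : Fact (0 < 2 * Real.pi) := ⟨Real.two_pi_pos⟩

/-- The phase interval `[0, 2π)` with addition modulo `2π`, that is, the circle `ℝ / 2πℤ`. Its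
topology is that of the circle; its Borel sets correspond to the Borel sets of `[0, 2π)`. -/
abbrev Phase : Type := AddCircle (2 * Real.pi)

/-- The translate `X ∔ θ` (addition modulo `2π`). -/
def shift (X : Set Phase) (θ : Phase) : Set Phase := (fun x => x + θ) '' X

/-! ### Normalized positive operator measures -/

/-- A normalized positive operator measure on the measurable space `Ω` with values in the bounded
operators of the Hilbert space `K`: a map on the measurable sets, with positive values, of total
mass the identity, and `σ`-additive with respect to the weak operator topology. As for Mathlib's
vector measures, nonmeasurable sets get the conventional value `0`. -/
structure OperatorMeasure (Ω : Type*) [MeasurableSpace Ω] (K : Type*) [NormedAddCommGroup K]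
    [InnerProductSpace ℂ K] where
  toFun : Set Ω → (K →L[ℂ] K)
  not_measurable : ∀ X, ¬ MeasurableSet X → toFun X = 0
  nonneg : ∀ X, MeasurableSet X → (toFun X).IsPositive
  univ : toFun Set.univ = ContinuousLinearMap.id ℂ K
  iUnion : ∀ X : ℕ → Set Ω, (∀ i, MeasurableSet (X i)) → Pairwise (Function.onFun Disjoint X) →
    ∀ φ ψ : K, HasSum (fun i => inner ℂ φ (toFun (X i) ψ)) (inner ℂ φ (toFun (⋃ i, X i) ψ))

namespace OperatorMeasure

variable {Ω : Type*} [MeasurableSpace Ω] {Ω' : Type*} [MeasurableSpace Ω']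
  {K : Type*} [NormedAddCommGroup K] [InnerProductSpace ℂ K]

instance : CoeFun (OperatorMeasure Ω K) (fun _ => Set Ω → (K →L[ℂ] K)) := ⟨toFun⟩

theorem empty (E : OperatorMeasure Ω K) (φ ψ : K) : inner ℂ φ (E ∅ ψ) = 0 := by
  have h := E.iUnion (fun _ => ∅) (fun _ => MeasurableSet.empty)
    (fun _ _ _ => by simp [Function.onFun]) φ ψ
  exact (summable_const_iff _).1 h.summable

/-- The image of an operator measure under a measurable map `f`: `X ↦ E (f⁻¹(X))`. -/
def map (E : OperatorMeasure Ω K) (f : Ω → Ω') (hf : Measurable f) : OperatorMeasure Ω' K where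
  toFun X := by classical exact if MeasurableSet X then E (f ⁻¹' X) else 0
  not_measurable X hX := by simp [hX]
  nonneg X hX := by simpa [hX] using E.nonneg _ (hf hX)
  univ := by simpa using E.univ
  iUnion X hX hd φ ψ := by
    have := E.iUnion (fun i => f ⁻¹' (X i)) (fun i => hf (hX i))
      (fun i j hij => (hd hij).preimage f) φ ψ
    simpa [hX, MeasurableSet.iUnion hX] using this

/-- The measure `X ↦ ⟨ψ| E(X) |ψ⟩`: for a unit vector `ψ` this is the distribution of the
observable `E` in the state `ψ`. -/
def distribution (E : OperatorMeasure Ω K) (ψ : K) : Measure Ω :=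
  Measure.ofMeasurable (fun X _ => ENNReal.ofReal (inner ℂ ψ (E X ψ)).re)
    (by simp [E.empty])
    (by
      intro X hX hd
      have h := Complex.hasSum_re (E.iUnion X hX hd ψ ψ)
      have h0 : ∀ i, 0 ≤ (inner ℂ ψ (E (X i) ψ)).re := fun i =>
        (E.nonneg (X i) (hX i)).re_inner_nonneg_right ψ
      rw [← h.tsum_eq, ENNReal.ofReal_tsum_of_nonneg h0 h.summable])

theorem distribution_apply (E : OperatorMeasure Ω K) (ψ : K) {X : Set Ω} (hX : MeasurableSet X) :
    E.distribution ψ X = ENNReal.ofReal (inner ℂ ψ (E X ψ)).re :=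
  Measure.ofMeasurable_apply X hX

instance (E : OperatorMeasure Ω K) (ψ : K) : IsFiniteMeasure (E.distribution ψ) :=
  ⟨by rw [distribution_apply E ψ MeasurableSet.univ]; exact ENNReal.ofReal_lt_top⟩

theorem distribution_real (E : OperatorMeasure Ω K) (ψ : K) {X : Set Ω} (hX : MeasurableSet X) :
    ((E.distribution ψ).real X : ℂ) = inner ℂ ψ (E X ψ) := by
  have hp := E.nonneg X hX
  have h0 : 0 ≤ (inner ℂ ψ (E X ψ)).re := hp.re_inner_nonneg_right ψ
  rw [Measure.real, distribution_apply E ψ hX, ENNReal.toReal_ofReal h0]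
  apply Complex.ext
  · simp
  · have := hp.isSymmetric ψ ψ
    have h2 : (starRingEnd ℂ) (inner ℂ ψ (E X ψ)) = inner ℂ ψ (E X ψ) := by
      rw [inner_conj_symm]; exact this
    simpa using (Complex.conj_eq_iff_im.1 h2).symm

end OperatorMeasure

/-! ### Phase observables of one mode

`H` is a Hilbert space with an orthonormal basis `b`, the number states: `b n` is `|n⟩`. -/

section OneMode

variable {H : Type*} [NormedAddCommGroup H] [InnerProductSpace ℂ H]

theorem orthonormal_phase (b : HilbertBasis ℕ ℂ H) (θ : ℝ) :
    Orthonormal ℂ (fun n : ℕ => Complex.exp (Complex.I * θ * n) • b n) := by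
  have hb := b.orthonormal
  have hn : ∀ n : ℕ, ‖Complex.exp (Complex.I * θ * n)‖ = 1 := fun n => by
    rw [Complex.norm_exp]; simp
  refine ⟨fun n => by rw [norm_smul, hn, hb.1 n, one_mul], fun n m hnm => ?_⟩
  simp [inner_smul_left, inner_smul_right, hb.2 hnm]

theorem phase_span (b : HilbertBasis ℕ ℂ H) (θ : ℝ) :
    ⊤ ≤ (Submodule.span ℂ (Set.range
      (fun n : ℕ => Complex.exp (Complex.I * θ * n) • b n))).topologicalClosure := by
  rw [← b.dense_span]
  refine Submodule.topologicalClosure_mono (Submodule.span_le.2 ?_)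
  rintro _ ⟨n, rfl⟩
  have h : Complex.exp (Complex.I * θ * n) • b n ∈ Submodule.span ℂ (Set.range
      (fun n : ℕ => Complex.exp (Complex.I * θ * n) • b n)) := Submodule.subset_span ⟨n, rfl⟩
  have h2 := Submodule.smul_mem _ (Complex.exp (Complex.I * θ * n))⁻¹ h
  rwa [smul_smul, inv_mul_cancel₀ (Complex.exp_ne_zero _), one_smul] at h2

/-- The unitary operator `e^{iθN}`, where `N` is the number operator `N |n⟩ = n |n⟩`: it maps
the basis vector `|n⟩` to `e^{iθn} |n⟩`. -/
def phaseShift [CompleteSpace H] (b : HilbertBasis ℕ ℂ H) (θ : ℝ) : H ≃ₗᵢ[ℂ] H :=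
  b.repr.trans (HilbertBasis.mk (orthonormal_phase b θ) (phase_span b θ)).repr.symm

theorem phaseShift_apply_basis [CompleteSpace H] (b : HilbertBasis ℕ ℂ H) (θ : ℝ) (n : ℕ) :
    phaseShift b θ (b n) = Complex.exp (Complex.I * θ * n) • b n := by
  classical
  simp [phaseShift, b.repr_self]

/-- A phase observable: a normalized positive operator measure `E` on the phase interval with
`e^{iθN} E(X) e^{-iθN} = E(X ∔ θ)` for all Borel sets `X` and all real `θ`. -/
def IsPhaseObservable [CompleteSpace H] (b : HilbertBasis ℕ ℂ H) (E : OperatorMeasure Phase H) : Prop :=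
  ∀ X : Set Phase, MeasurableSet X → ∀ (θ : ℝ) (ψ : H),
    phaseShift b θ (E X ((phaseShift b θ).symm ψ)) = E (shift X (θ : Phase)) ψ

/-- `c` is the phase matrix of `E`:
`E(X) = ∑ₙₘ cₙₘ (1/2π) ∫_X e^{i(n-m)θ} dθ |n⟩⟨m|`, the series being understood weakly. -/
def IsPhaseMatrix (b : HilbertBasis ℕ ℂ H) (E : OperatorMeasure Phase H) (c : ℕ → ℕ → ℂ) : Prop :=
  ∀ X : Set Phase, MeasurableSet X → ∀ n m : ℕ,
    inner ℂ (b n) (E X (b m)) =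
      c n m * ∫ θ in X, fourier ((n : ℤ) - (m : ℤ)) θ ∂AddCircle.haarAddCircle

theorem measurableSet_shift {X : Set Phase} (hX : MeasurableSet X) (θ : Phase) :
    MeasurableSet (shift X θ) := by
  rw [shift, Set.image_add_right]
  exact hX.preimage (measurable_add_const _)

theorem integral_fourier_mul_real_shift (μ : Measure Phase) [IsFiniteMeasure μ] {X : Set Phase}
    (hX : MeasurableSet X) (q : ℤ) :
    ∫ θ, fourier (-q) θ * (μ.real (shift X θ) : ℂ) ∂AddCircle.haarAddCircle =
      (∫ x, fourier (-q) x ∂μ) * ∫ y in X, fourier q y ∂AddCircle.haarAddCircle := by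
  have h1 : ∀ θ : Phase, (μ.real (shift X θ) : ℂ) =
      ∫ x, X.indicator (fun _ => (1 : ℂ)) (x - θ) ∂μ := by
    intro θ
    have : (fun x => X.indicator (fun _ => (1 : ℂ)) (x - θ)) =
        (shift X θ).indicator (fun _ => (1 : ℂ)) := by
      funext x
      have hmem : x ∈ shift X θ ↔ x - θ ∈ X := by
        rw [shift, Set.image_add_right, Set.mem_preimage, sub_eq_add_neg]
      by_cases hx : x - θ ∈ X
      · rw [Set.indicator_of_mem hx, Set.indicator_of_mem (hmem.2 hx)]
      · rw [Set.indicator_of_notMem hx, Set.indicator_of_notMem (mt hmem.1 hx)]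
    rw [this, integral_indicator (measurableSet_shift hX θ)]
    simp
  have hmeas : Measurable (fun p : Phase × Phase =>
      fourier (-q) p.1 * X.indicator (fun _ => (1 : ℂ)) (p.2 - p.1)) :=
    ((map_continuous (fourier (-q))).measurable.comp measurable_fst).mul
      ((measurable_const.indicator hX).comp (measurable_snd.sub measurable_fst))
  have hnorm : ∀ (n : ℤ) (x : Phase), ‖fourier n x‖ = 1 := fun n x => by
    rw [fourier_apply]; exact Circle.norm_coe _
  simp_rw [h1, ← integral_const_mul]
  rw [integral_integral_swap]
  · have h2 : ∀ x : Phase, ∫ θ, fourier (-q) θ * X.indicator (fun _ => (1 : ℂ)) (x - θ)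
        ∂AddCircle.haarAddCircle =
        fourier (-q) x * ∫ y in X, fourier q y ∂AddCircle.haarAddCircle := by
      intro x
      rw [← integral_sub_left_eq_self _ _ x, ← integral_indicator hX, ← integral_const_mul]
      congr 1
      funext y
      by_cases hy : y ∈ X
      · simp [hy, AddCircle.toCircle_add, sub_eq_add_neg, fourier_apply]
      · simp [hy]
    exact (integral_congr_ae (Eventually.of_forall h2)).trans
      ((integral_mul_const (μ := μ) _ (fun x => fourier (-q) x)).trans
        (integral_const_mul _ _).symm)
  · refine Integrable.of_bound hmeas.aestronglyMeasurable 1 (Eventually.of_forall fun p => ?_)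
    simp only [Function.uncurry, norm_mul, hnorm, one_mul]
    by_cases hp : p.2 - p.1 ∈ X <;> simp [hp]

theorem inner_shift [CompleteSpace H] {b : HilbertBasis ℕ ℂ H} {E : OperatorMeasure Phase H}
    (hE : IsPhaseObservable b E) {X : Set Phase} (hX : MeasurableSet X) (θ : ℝ) (n m : ℕ) :
    inner ℂ (b n) (E (shift X θ) (b m)) =
      fourier ((n : ℤ) - (m : ℤ)) (θ : Phase) * inner ℂ (b n) (E X (b m)) := by
  have hs : ∀ k, (phaseShift b θ).symm (b k) = Complex.exp (-(Complex.I * θ * k)) • b k := by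
    intro k
    rw [LinearIsometryEquiv.symm_apply_eq, map_smul, phaseShift_apply_basis, smul_smul,
      ← Complex.exp_add]
    simp
  have hf : ∀ y : H, inner ℂ (b n) (phaseShift b θ y) =
      inner ℂ ((phaseShift b θ).symm (b n)) y := fun y => by
    rw [LinearIsometryEquiv.inner_map_eq_flip, LinearIsometryEquiv.symm_symm]
  rw [← hE X hX, hf, hs, hs, map_smul, inner_smul_left,
    inner_smul_right, fourier_coe_apply, ← mul_assoc]
  congr 1
  rw [← Complex.exp_conj, ← Complex.exp_add]
  congr 1
  have : (Real.pi : ℂ) ≠ 0 := by exact_mod_cast Real.pi_ne_zero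
  simp
  field_simp
  ring

theorem exists_phaseMatrix [CompleteSpace H] {b : HilbertBasis ℕ ℂ H}
    {E : OperatorMeasure Phase H} (hE : IsPhaseObservable b E) : ∃ c, IsPhaseMatrix b E c := by
  have key : ∀ n m : ℕ, ∃ c : ℂ, ∀ X : Set Phase, MeasurableSet X →
      inner ℂ (b n) (E X (b m)) =
        c * ∫ θ in X, fourier ((n : ℤ) - (m : ℤ)) θ ∂AddCircle.haarAddCircle := by
    intro n m
    set q : ℤ := (n : ℤ) - (m : ℤ) with hq
    let μ₁ := E.distribution (b n + b m)
    let μ₂ := E.distribution (b n - b m)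
    let μ₃ := E.distribution (b n + Complex.I • b m)
    let μ₄ := E.distribution (b n - Complex.I • b m)
    have hpol : ∀ X : Set Phase, MeasurableSet X → inner ℂ (b n) (E X (b m)) =
        (4⁻¹ : ℂ) * ((μ₁.real X : ℂ) - (μ₂.real X : ℂ) - Complex.I * (μ₃.real X : ℂ)
          + Complex.I * (μ₄.real X : ℂ)) := by
      intro X hX
      simp only [μ₁, μ₂, μ₃, μ₄, OperatorMeasure.distribution_real E _ hX]
      simp only [map_add, map_sub, map_smul, inner_add_left, inner_add_right, inner_sub_left,
        inner_sub_right, inner_smul_left, inner_smul_right, Complex.conj_I]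
      ring_nf
      simp only [Complex.I_sq]
      ring
    have hnorm : ∀ (n : ℤ) (x : Phase), ‖fourier n x‖ = 1 := fun n x => by
      rw [fourier_apply]; exact Circle.norm_coe _
    have hint : ∀ (μ : Measure Phase) [IsFiniteMeasure μ] (X : Set Phase), MeasurableSet X →
        Integrable (fun θ : Phase => fourier (-q) θ * (μ.real (shift X θ) : ℂ))
          AddCircle.haarAddCircle := by
      intro μ _ X hX
      have hm : Measurable (fun θ : Phase => μ (shift X θ)) := by
        have hS : MeasurableSet {p : Phase × Phase | p.2 - p.1 ∈ X} :=
          hX.preimage (measurable_snd.sub measurable_fst)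
        convert! measurable_measure_prodMk_left (ν := μ) hS using 2 with θ
        rw [shift, Set.image_add_right]
        congr 1
        ext x
        simp [sub_eq_add_neg]
      refine Integrable.of_bound (C := μ.real Set.univ) ?_ (Eventually.of_forall fun θ => ?_)
      · exact ((map_continuous (fourier (-q))).measurable.mul
          (Complex.measurable_ofReal.comp hm.ennreal_toReal)).aestronglyMeasurable
      · rw [norm_mul, hnorm, one_mul, Complex.norm_real, Real.norm_of_nonneg measureReal_nonneg]
        exact measureReal_mono (Set.subset_univ _)
    refine ⟨4⁻¹ * ((∫ x, fourier (-q) x ∂μ₁) - (∫ x, fourier (-q) x ∂μ₂)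
      - Complex.I * (∫ x, fourier (-q) x ∂μ₃) + Complex.I * (∫ x, fourier (-q) x ∂μ₄)), ?_⟩
    intro X hX
    have h1 : ∫ θ : Phase, fourier (-q) θ * inner ℂ (b n) (E (shift X θ) (b m))
        ∂AddCircle.haarAddCircle = inner ℂ (b n) (E X (b m)) := by
      have : ∀ θ : Phase, fourier (-q) θ * inner ℂ (b n) (E (shift X θ) (b m)) =
          inner ℂ (b n) (E X (b m)) := by
        intro θ
        induction θ using QuotientAddGroup.induction_on with
        | H t =>
          have := inner_shift hE hX t n m
          rw [← hq] at this
          refine (congrArg _ this).trans ?_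
          rw [← mul_assoc, ← fourier_add]
          simp
      refine (integral_congr_ae (Eventually.of_forall this)).trans ?_
      simp
    rw [← h1]
    have h2 : ∀ θ : Phase, fourier (-q) θ * inner ℂ (b n) (E (shift X θ) (b m)) =
        4⁻¹ * (fourier (-q) θ * (μ₁.real (shift X θ) : ℂ)
          - fourier (-q) θ * (μ₂.real (shift X θ) : ℂ)
          - Complex.I * (fourier (-q) θ * (μ₃.real (shift X θ) : ℂ))
          + Complex.I * (fourier (-q) θ * (μ₄.real (shift X θ) : ℂ))) := by
      intro θ
      rw [hpol _ (measurableSet_shift hX θ)]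
      ring
    simp_rw [h2]
    rw [integral_const_mul, integral_add, integral_sub, integral_sub, integral_const_mul,
      integral_const_mul, integral_fourier_mul_real_shift μ₁ hX, integral_fourier_mul_real_shift μ₂ hX,
      integral_fourier_mul_real_shift μ₃ hX, integral_fourier_mul_real_shift μ₄ hX]
    · ring
    · exact hint μ₁ X hX
    · exact hint μ₂ X hX
    · exact (hint μ₁ X hX).sub (hint μ₂ X hX)
    · exact (hint μ₃ X hX).const_mul _
    · exact ((hint μ₁ X hX).sub (hint μ₂ X hX)).sub ((hint μ₃ X hX).const_mul _)
    · exact (hint μ₄ X hX).const_mul _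
  choose c hc using key
  exact ⟨c, fun X hX n m => hc n m X hX⟩

/-- The phase matrix `(cₙₘ)` of a phase observable. -/
def phaseMatrix [CompleteSpace H] (b : HilbertBasis ℕ ℂ H) (E : OperatorMeasure Phase H)
    (hE : IsPhaseObservable b E) : ℕ → ℕ → ℂ :=
  (exists_phaseMatrix hE).choose

theorem phaseMatrix_spec [CompleteSpace H] (b : HilbertBasis ℕ ℂ H) (E : OperatorMeasure Phase H)
    (hE : IsPhaseObservable b E) : IsPhaseMatrix b E (phaseMatrix b E hE) :=
  (exists_phaseMatrix hE).choose_spec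

/-- The coherent state `|z⟩ = e^{-|z|²/2} ∑ₙ zⁿ / √(n!) |n⟩`. -/
def coherent (b : HilbertBasis ℕ ℂ H) (z : ℂ) : H :=
  ((Real.exp (-‖z‖ ^ 2 / 2) : ℝ) : ℂ) •
    ∑' n : ℕ, (z ^ n / ((Real.sqrt (Nat.factorial n) : ℝ) : ℂ)) • b n

/-- The series that defines the coherent states converges. -/
theorem summable_coherent [CompleteSpace H] (b : HilbertBasis ℕ ℂ H) (z : ℂ) :
    Summable (fun n : ℕ => (z ^ n / ((Real.sqrt (Nat.factorial n) : ℝ) : ℂ)) • b n) := by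
  have h : Memℓp (fun n : ℕ => z ^ n / ((Real.sqrt (Nat.factorial n) : ℝ) : ℂ)) 2 := by
    refine memℓp_gen ?_
    refine (Real.summable_pow_div_factorial (‖z‖ ^ 2)).congr fun n => ?_
    simp [div_pow, abs_of_nonneg, Real.sqrt_nonneg, ← pow_mul, mul_comm]
  exact (b.hasSum_repr_symm ⟨_, h⟩).summable

end OneMode

/-! ### Two modes -/

section TwoModes

variable {H : Type*} [NormedAddCommGroup H] [InnerProductSpace ℂ H]

/-- The Hilbert space tensor product `H ⊗ H`. -/
abbrev TwoMode (H : Type*) [NormedAddCommGroup H] [InnerProductSpace ℂ H] : Type _ :=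
  UniformSpace.Completion (H ⊗[ℂ] H)

/-- The elementary tensor `φ ⊗ ψ` in the Hilbert space `H ⊗ H`. -/
def elem (φ ψ : H) : TwoMode H := ((φ ⊗ₜ[ℂ] ψ : H ⊗[ℂ] H) : UniformSpace.Completion (H ⊗[ℂ] H))

/-- The tensor product `A ⊗ B` of two bounded operators, a bounded operator on `H ⊗ H`. -/
def tensorOp (A B : H →L[ℂ] H) : TwoMode H →L[ℂ] TwoMode H :=
  ((UniformSpace.Completion.toComplL (𝕜 := ℂ) (E := H ⊗[ℂ] H)).comp (mapL A B)).extend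
    (UniformSpace.Completion.toComplL (𝕜 := ℂ) (E := H ⊗[ℂ] H))

theorem tensorOp_elem (A B : H →L[ℂ] H) (φ ψ : H) :
    tensorOp A B (elem φ ψ) = elem (A φ) (B ψ) := by
  have := ContinuousLinearMap.extend_eq
    ((UniformSpace.Completion.toComplL (𝕜 := ℂ) (E := H ⊗[ℂ] H)).comp (mapL A B))
    (e := UniformSpace.Completion.toComplL (𝕜 := ℂ) (E := H ⊗[ℂ] H))
    UniformSpace.Completion.denseRange_coe
    (UniformSpace.Completion.isUniformInducing_coe _) (φ ⊗ₜ[ℂ] ψ)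
  simpa [tensorOp, elem] using this

/-- `Et` is the product of `E₁` and `E₂`: `Et(X × Y) = E₁(X) ⊗ E₂(Y)` for Borel sets `X`, `Y`. -/
def IsProduct (E₁ E₂ : OperatorMeasure Phase H) (Et : OperatorMeasure (Phase × Phase) (TwoMode H)) :
    Prop :=
  ∀ X Y : Set Phase, MeasurableSet X → MeasurableSet Y → Et (X ×ˢ Y) = tensorOp (E₁ X) (E₂ Y)

/-- The phase difference `X ↦ Et(f⁻¹(X))`, `f(x, y) = x - y` modulo `2π`. If `Et` is the product of
`E₁` and `E₂`, this is the difference of `E₁` and `E₂`. -/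
def difference (Et : OperatorMeasure (Phase × Phase) (TwoMode H)) :
    OperatorMeasure Phase (TwoMode H) :=
  Et.map (fun p => p.1 - p.2) (measurable_fst.sub measurable_snd)

/-- The two-mode coherent state `|z₁, z₂⟩ = |z₁⟩ ⊗ |z₂⟩`. -/
def coherent₂ (b : HilbertBasis ℕ ℂ H) (z₁ z₂ : ℂ) : TwoMode H :=
  elem (coherent b z₁) (coherent b z₂)

end TwoModes

end QuantumPhase

end

open QuantumPhase

/-!
The state `|z₁, z₂⟩` is a product vector, so in it the outcomes of `E₁` and `E₂` are independent and
the phase difference is distributed as `x - y` under the product of the two one-mode distributions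
(`IsProduct.distribution_difference_elem`). Everything reduces to the behaviour of one mode.

*The product measure.* With respect to the Haar measure, `E` has the matrix-valued density
`θ ↦ (cₙₘ e^{i(n-m)θ})`, which is positive semidefinite at every `θ`
(`IsPhaseMatrix.posSemidef_phaseDensity`). The entrywise product of the densities of `E₁` and `E₂`
is positive semidefinite by Schur's theorem, and a positive semidefinite density of total integral
`1` is the density of an operator measure (`exists_operatorMeasure_of_density`); its operators are
weak limits of finite sections (`exists_operator_of_posSemidef`). This is `E₁ ⊗ E₂`
(`exists_isProduct`). Uniqueness holds since, in every state, a finite measure on a product is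
determined by rectangles (`IsProduct.unique`).

*The classical limit of one mode.* The `k`-th Fourier coefficient of the distribution of `E` in the
state `∑ aₙ |n⟩` is `∑ₙ conj aₙ · aₙ₊ₖ · cₙ,ₙ₊ₖ`
(`IsPhaseMatrix.tendsto_integral_fourier_distribution`). For `|r e^{iη}⟩` the factor
`conj aₙ · aₙ₊ₖ` is `e^{ikη}` times a nonnegative weight, the geometric mean of two Poisson
probabilities of mean `r²`. As `r → ∞` every weight tends to `0`, while their sum tends to `1`
(`tendsto_tsum_amplitude_mul`), so the weighted mean of `cₙ,ₙ₊ₖ` tends to its limit `e^{-ikα}`, and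
the Fourier coefficient tends to `e^{ik(η-α)}`. By density of the trigonometric polynomials the
distribution converges weakly to the Dirac measure at `η - α`
(`tendsto_integral_of_tendsto_fourier`).

*Conclusion.* The probability of a phase difference in `X` is the mean, over the second mode, of
`y ↦ ⟨z₁|E₁(X ∔ y)|z₁⟩`. This function is continuous for every Borel set `X`, by covariance
(`continuous_distribution_shift`), so the first limit needs no condition on the boundary of `X`.
If both modes become classical, the Fourier coefficients of the difference are the products of
those of the first mode and the conjugates of those of the second, and the portmanteau theorem
gives the convergence on sets.
-/

noncomputable section

open scoped ComplexOrder

namespace QuantumPhase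

/-! ### Operators on a Hilbert space given by their matrices -/

section Operators

variable {K : Type*} [NormedAddCommGroup K] [InnerProductSpace ℂ K]
  {ι : Type*}

theorem norm_le_one_of_isPositive [CompleteSpace K] {T : K →L[ℂ] K} (hT : T.IsPositive)
    (hT' : (1 - T).IsPositive) : ‖T‖ ≤ 1 := by
  have h0 : 0 ≤ T := (ContinuousLinearMap.nonneg_iff_isPositive T).2 hT
  have h1 : T ≤ 1 := (ContinuousLinearMap.le_def T 1).2 hT'
  exact (CStarAlgebra.norm_le_one_iff_of_nonneg T h0).2 h1

/-- A uniformly bounded net of functionals converges pointwise as soon as it converges on a Hilbert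
basis. -/
theorem tendsto_apply_of_forall_basis {J : Type*} {l : Filter J} (e : HilbertBasis ι ℂ K)
    (f : J → K →L[ℂ] ℂ) (f₀ : K →L[ℂ] ℂ) {C : ℝ} (hf : ∀ᶠ j in l, ‖f j‖ ≤ C)
    (h : ∀ i, Tendsto (fun j => f j (e i)) l (𝓝 (f₀ (e i)))) (φ : K) :
    Tendsto (fun j => f j φ) l (𝓝 (f₀ φ)) := by
  have hspan : ∀ ξ ∈ Submodule.span ℂ (Set.range e),
      Tendsto (fun j => f j ξ) l (𝓝 (f₀ ξ)) := by
    intro ξ hξ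
    induction hξ using Submodule.span_induction with
    | mem x hx => obtain ⟨i, rfl⟩ := hx; exact h i
    | zero => simpa using tendsto_const_nhds
    | add x y _ _ hx hy => simpa using hx.add hy
    | smul c x _ hx => simpa using hx.const_mul c
  have hdense : Dense (Submodule.span ℂ (Set.range e) : Set K) :=
    (Submodule.dense_iff_topologicalClosure_eq_top).2 e.dense_span
  rw [Metric.tendsto_nhds]
  intro ε hε
  -- Approximate `φ` by `ξ` in the span; `D` bounds the Lipschitz constant of `f j - f₀`.
  obtain ⟨D, hD0, hD⟩ : ∃ D : ℝ, 0 < D ∧ C + ‖f₀‖ ≤ D :=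
    ⟨max 1 (C + ‖f₀‖), lt_max_of_lt_left one_pos, le_max_right _ _⟩
  obtain ⟨ξ, hξ, hφξ⟩ := Metric.dense_iff.1 hdense φ (ε / (2 * D)) (by positivity)
  have hφξ' : ‖φ - ξ‖ < ε / (2 * D) := by
    rw [← dist_eq_norm, dist_comm]; exact hξ
  filter_upwards [hf, Metric.tendsto_nhds.1 (hspan ξ hφξ) (ε / 2) (by positivity)] with j hj hjξ
  have h1 : ‖f j (φ - ξ)‖ ≤ C * ‖φ - ξ‖ := (f j).le_of_opNorm_le hj _
  have h2 : ‖f₀ (φ - ξ)‖ ≤ ‖f₀‖ * ‖φ - ξ‖ := f₀.le_opNorm _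
  have h3 : D * ‖φ - ξ‖ < ε / 2 := by
    calc D * ‖φ - ξ‖ < D * (ε / (2 * D)) := by gcongr
      _ = ε / 2 := by field_simp
  have h4 : (C + ‖f₀‖) * ‖φ - ξ‖ ≤ D * ‖φ - ξ‖ := by gcongr
  rw [dist_eq_norm] at hjξ ⊢
  calc ‖f j φ - f₀ φ‖ = ‖f j (φ - ξ) - f₀ (φ - ξ) + (f j ξ - f₀ ξ)‖ := by
        congr 1; simp only [map_sub]; ring
    _ ≤ ‖f j (φ - ξ)‖ + ‖f₀ (φ - ξ)‖ + ‖f j ξ - f₀ ξ‖ :=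
        (norm_add_le _ _).trans (by gcongr; exact norm_sub_le _ _)
    _ < ε := by linarith

/-- A uniformly bounded net of operators converges in the weak operator topology as soon as its
matrix elements converge. -/
theorem tendsto_inner_of_forall_basis {J : Type*} {l : Filter J} (e : HilbertBasis ι ℂ K)
    (T : J → K →L[ℂ] K) (T₀ : K →L[ℂ] K) {C : ℝ} (hT : ∀ᶠ j in l, ‖T j‖ ≤ C)
    (h : ∀ i k, Tendsto (fun j => inner ℂ (e i) (T j (e k))) l (𝓝 (inner ℂ (e i) (T₀ (e k)))))
    (φ ψ : K) : Tendsto (fun j => inner ℂ φ (T j ψ)) l (𝓝 (inner ℂ φ (T₀ ψ))) := by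
  have h1 : ∀ i ψ, Tendsto (fun j => inner ℂ (e i) (T j ψ)) l (𝓝 (inner ℂ (e i) (T₀ ψ))) := by
    intro i ψ
    refine tendsto_apply_of_forall_basis e (fun j => (innerSL ℂ (e i)).comp (T j))
      ((innerSL ℂ (e i)).comp T₀) (C := C) ?_ (fun k => by simpa using h i k) ψ
    filter_upwards [hT] with j hj
    refine (ContinuousLinearMap.opNorm_comp_le _ _).trans ?_
    rwa [innerSL_apply_norm, e.orthonormal.1 i, one_mul]
  -- The inner product is conjugate linear in `φ`, so the two arguments are exchanged.
  have h2 : Tendsto (fun j => inner ℂ (T j ψ) φ) l (𝓝 (inner ℂ (T₀ ψ) φ)) := by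
    refine tendsto_apply_of_forall_basis e (fun j => innerSL ℂ (T j ψ)) (innerSL ℂ (T₀ ψ))
      (C := C * ‖ψ‖) ?_ (fun i => ?_) φ
    · filter_upwards [hT] with j hj
      rw [innerSL_apply_norm]
      exact (T j).le_of_opNorm_le hj ψ
    · have := (Complex.continuous_conj.tendsto _).comp (h1 i ψ)
      simpa [Function.comp_def, inner_conj_symm] using this
  have := (Complex.continuous_conj.tendsto _).comp h2
  simpa [Function.comp_def, inner_conj_symm] using this

theorem ext_of_inner_basis (e : HilbertBasis ι ℂ K) {S T : K →L[ℂ] K}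
    (h : ∀ i j, inner ℂ (e i) (S (e j)) = inner ℂ (e i) (T (e j))) : S = T := by
  ext ψ
  refine ext_inner_left ℂ fun φ => ?_
  refine tendsto_nhds_unique (l := (pure () : Filter Unit)) (f := fun _ => inner ℂ φ (S ψ))
    tendsto_const_nhds ?_
  exact tendsto_inner_of_forall_basis e (fun _ => S) T (C := ‖S‖) (by simp)
    (fun i j => by rw [h]; exact tendsto_const_nhds) φ ψ

end Operators

section Matrices

variable {ι : Type*}

theorem _root_.Matrix.PosSemidef.finset_sum_nonneg {A : Matrix ι ι ℂ} (hA : A.PosSemidef)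
    (F : Finset ι) (u : ι → ℂ) :
    0 ≤ ∑ i ∈ F, ∑ j ∈ F, (starRingEnd ℂ) (u i) * A i j * u j := by
  classical
  have h := hA.2 (Finsupp.indicator F fun i _ => u i)
  rw [Finsupp.sum_of_support_subset (s := F) _ (Finsupp.support_indicator_subset _ _) _
    (by simp)] at h
  refine h.trans_eq (Finset.sum_congr rfl fun i hi => ?_)
  rw [Finsupp.sum_of_support_subset (s := F) _ (Finsupp.support_indicator_subset _ _) _ (by simp)]
  refine Finset.sum_congr rfl fun j hj => ?_
  simp [Finsupp.indicator_apply, hi, hj]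

variable {K : Type*} [NormedAddCommGroup K] [InnerProductSpace ℂ K]

/-- The finite section `∑_{i, j ∈ F} A_{ij} |e_i⟩⟨e_j|` of the operator with matrix `A`. -/
def finiteSection (e : HilbertBasis ι ℂ K) (A : Matrix ι ι ℂ) (F : Finset ι) : K →L[ℂ] K :=
  ∑ i ∈ F, ∑ j ∈ F, A i j • InnerProductSpace.rankOne ℂ (e i) (e j)

theorem inner_finiteSection (e : HilbertBasis ι ℂ K) (A : Matrix ι ι ℂ) (F : Finset ι)
    (φ ψ : K) : inner ℂ φ (finiteSection e A F ψ) =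
      ∑ i ∈ F, ∑ j ∈ F, inner ℂ φ (e i) * A i j * inner ℂ (e j) ψ := by
  simp only [finiteSection, sum_apply, inner_sum,
    smul_apply, InnerProductSpace.rankOne_apply, inner_smul_right]
  exact Finset.sum_congr rfl fun i _ => Finset.sum_congr rfl fun j _ => by ring

theorem isPositive_of_inner_nonneg {T : K →L[ℂ] K} (h : ∀ φ, 0 ≤ inner ℂ φ (T φ)) :
    T.IsPositive := by
  rw [ContinuousLinearMap.isPositive_iff_complex]
  intro φ
  have h1 := h φ
  have h2 : inner ℂ (T φ) φ = inner ℂ φ (T φ) := by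
    rw [← inner_conj_symm, Complex.conj_eq_iff_im]
    exact (Complex.nonneg_iff.1 h1).2.symm
  rw [h2]
  obtain ⟨hr, hi⟩ := Complex.nonneg_iff.1 h1
  exact ⟨Complex.ext rfl (by simpa using hi), hr⟩

theorem isPositive_finiteSection (e : HilbertBasis ι ℂ K) {A : Matrix ι ι ℂ}
    (hA : A.PosSemidef) (F : Finset ι) : (finiteSection e A F).IsPositive := by
  refine isPositive_of_inner_nonneg fun φ => ?_
  rw [inner_finiteSection]
  simpa [inner_conj_symm] using hA.finset_sum_nonneg F fun i => inner ℂ (e i) φ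

theorem isPositive_one_sub_finiteSection [DecidableEq ι] (e : HilbertBasis ι ℂ K)
    {A : Matrix ι ι ℂ} (hA : (1 - A).PosSemidef) (F : Finset ι) :
    (1 - finiteSection e A F).IsPositive := by
  refine isPositive_of_inner_nonneg fun φ => ?_
  have h := hA.finset_sum_nonneg F fun i => inner ℂ (e i) φ
  have h1 : ∑ i ∈ F, ∑ j ∈ F, (starRingEnd ℂ) (inner ℂ (e i) φ) * (1 - A) i j * inner ℂ (e j) φ =
      ((∑ i ∈ F, ‖inner ℂ (e i) φ‖ ^ 2 : ℝ) : ℂ) - inner ℂ φ (finiteSection e A F φ) := by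
    rw [inner_finiteSection]
    push_cast
    rw [← Finset.sum_sub_distrib]
    refine Finset.sum_congr rfl fun i hi => ?_
    simp only [Matrix.sub_apply, mul_sub, sub_mul, Finset.sum_sub_distrib, inner_conj_symm]
    congr 1
    simp only [Matrix.one_apply, mul_ite, mul_one, mul_zero, ite_mul, zero_mul,
      Finset.sum_ite_eq, hi, if_true]
    rw [← inner_conj_symm φ (e i), mul_comm, Complex.mul_conj, Complex.normSq_eq_norm_sq]
    push_cast; rfl
  -- Bessel's inequality.
  have h2 : ((∑ i ∈ F, ‖inner ℂ (e i) φ‖ ^ 2 : ℝ) : ℂ) ≤ inner ℂ φ φ := by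
    rw [inner_self_eq_norm_sq_to_K, ← RCLike.ofReal_pow]
    exact Complex.real_le_real.2 (e.orthonormal.sum_inner_products_le φ)
  rw [h1] at h
  simp only [sub_apply, one_apply_eq_self, inner_sub_right]
  exact h.trans (sub_le_sub_right h2 _)

/-- A matrix `A` with `0 ≤ A ≤ 1` is the matrix of a positive contraction: the limit of its finite
sections along an ultrafilter, in the weak operator topology. -/
theorem exists_operator_of_posSemidef [CompleteSpace K] [DecidableEq ι] (e : HilbertBasis ι ℂ K)
    {A : Matrix ι ι ℂ} (hA : A.PosSemidef) (hA' : (1 - A).PosSemidef) :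
    ∃ T : K →L[ℂ] K, T.IsPositive ∧ ∀ i j, inner ℂ (e i) (T (e j)) = A i j := by
  let U : Ultrafilter (Finset ι) := Ultrafilter.of atTop
  have hU : (U : Filter (Finset ι)) ≤ atTop := Ultrafilter.of_le atTop
  have hnorm : ∀ F, ‖finiteSection e A F‖ ≤ 1 := fun F =>
    norm_le_one_of_isPositive (isPositive_finiteSection e hA F)
      (isPositive_one_sub_finiteSection e hA' F)
  have hbd : ∀ φ ψ F, ‖inner ℂ (finiteSection e A F φ) ψ‖ ≤ ‖φ‖ * ‖ψ‖ := fun φ ψ F => by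
    refine (norm_inner_le_norm _ _).trans ?_
    gcongr
    simpa using (finiteSection e A F).le_of_opNorm_le (hnorm F) φ
  have hlim : ∀ φ ψ, ∃ c, Tendsto (fun F => inner ℂ (finiteSection e A F φ) ψ) U (𝓝 c) := by
    intro φ ψ
    obtain ⟨c, -, hc⟩ := (isCompact_closedBall (0 : ℂ) (‖φ‖ * ‖ψ‖)).ultrafilter_le_nhds
      (U.map fun F => inner ℂ (finiteSection e A F φ) ψ)
      (by
        rw [le_principal_iff]
        exact Filter.mem_map.2 (Eventually.of_forall fun F => by simpa using hbd φ ψ F))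
    exact ⟨c, hc⟩
  choose B hB using hlim
  let B' : K →ₗ⋆[ℂ] K →ₗ[ℂ] ℂ := LinearMap.mk₂'ₛₗ (starRingEnd ℂ) (RingHom.id ℂ) B
    (fun φ φ' ψ => tendsto_nhds_unique (hB _ _)
      (by simpa [inner_add_left] using (hB φ ψ).add (hB φ' ψ)))
    (fun c φ ψ => tendsto_nhds_unique (hB _ _)
      (by simpa [inner_smul_left, mul_comm] using (hB φ ψ).const_mul (starRingEnd ℂ c)))
    (fun φ ψ ψ' => tendsto_nhds_unique (hB _ _)
      (by simpa [inner_add_right] using (hB φ ψ).add (hB φ ψ')))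
    (fun c φ ψ => tendsto_nhds_unique (hB _ _)
      (by simpa [inner_smul_right] using (hB φ ψ).const_mul c))
  let T := InnerProductSpace.continuousLinearMapOfBilin (𝕜 := ℂ) (B'.mkContinuous₂ 1
    (fun φ ψ => by
      rw [one_mul]
      exact le_of_tendsto (hB φ ψ).norm (Eventually.of_forall fun F => hbd φ ψ F)))
  have hT : ∀ φ ψ, Tendsto (fun F => inner ℂ (finiteSection e A F φ) ψ) U
      (𝓝 (inner ℂ (T φ) ψ)) := by
    intro φ ψ
    have : inner ℂ (T φ) ψ = B φ ψ := by
      simp only [T, InnerProductSpace.continuousLinearMapOfBilin_apply]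
      rfl
    rw [this]; exact hB φ ψ
  have hpos : T.IsPositive := by
    refine isPositive_of_inner_nonneg fun φ => ?_
    have h1 : Tendsto (fun F => inner ℂ φ (finiteSection e A F φ)) U (𝓝 (inner ℂ φ (T φ))) := by
      have := (Complex.continuous_conj.tendsto _).comp (hT φ φ)
      simpa [Function.comp_def, inner_conj_symm] using this
    exact ge_of_tendsto' h1 fun F => (isPositive_finiteSection e hA F).inner_nonneg_right φ
  refine ⟨T, hpos, fun i j => ?_⟩
  rw [← hpos.inner_left_eq_inner_right]
  -- The matrix elements of the finite sections are eventually constant.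
  refine tendsto_nhds_unique (hT (e i) (e j)) (tendsto_const_nhds.congr' ?_)
  filter_upwards [hU (eventually_ge_atTop {i, j})] with F hF
  have hi : i ∈ F := hF (by simp)
  have hj : j ∈ F := hF (by simp)
  rw [(isPositive_finiteSection e hA F).inner_left_eq_inner_right, inner_finiteSection]
  simp [orthonormal_iff_ite.1 e.orthonormal, hi, hj]

end Matrices

/-! ### Operator measures -/

section Density

variable {Ω : Type*} [MeasurableSpace Ω] {ι : Type*}

theorem posSemidef_setIntegral {μ : Measure Ω} {D : Ω → Matrix ι ι ℂ}
    (hD : ∀ p, (D p).PosSemidef) (hint : ∀ i j, Integrable (fun p => D p i j) μ) (S : Set Ω) :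
    Matrix.PosSemidef (Matrix.of fun i j => ∫ p in S, D p i j ∂μ) := by
  refine ⟨?_, fun x => ?_⟩
  · ext i j
    simp only [Matrix.conjTranspose_apply, Matrix.of_apply, Complex.star_def]
    rw [← integral_conj]
    exact integral_congr_ae (Eventually.of_forall fun p => (hD p).1.apply i j)
  · simp only [Finsupp.sum, Matrix.of_apply]
    have h : ∑ i ∈ x.support, ∑ j ∈ x.support, star (x i) * (∫ p in S, D p i j ∂μ) * x j =
        ∫ p in S, ∑ i ∈ x.support, ∑ j ∈ x.support, star (x i) * D p i j * x j ∂μ := by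
      rw [integral_finsetSum]
      · refine Finset.sum_congr rfl fun i _ => ?_
        rw [integral_finsetSum]
        · refine Finset.sum_congr rfl fun j _ => ?_
          rw [integral_mul_const, integral_const_mul]
        · exact fun j _ => ((hint i j).integrableOn.const_mul _).mul_const _
      · exact fun i _ => integrable_finsetSum _ fun j _ =>
          ((hint i j).integrableOn.const_mul _).mul_const _
    rw [h]
    exact integral_nonneg fun p => (hD p).finset_sum_nonneg x.support x

variable {K : Type*} [NormedAddCommGroup K] [InnerProductSpace ℂ K] [CompleteSpace K]

/-- Every positive semidefinite matrix-valued density of total integral `1` is the density of an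
operator measure. -/
theorem exists_operatorMeasure_of_density [DecidableEq ι] {μ : Measure Ω}
    (e : HilbertBasis ι ℂ K) {D : Ω → Matrix ι ι ℂ}
    (hD : ∀ p, (D p).PosSemidef) (hint : ∀ i j, Integrable (fun p => D p i j) μ)
    (h1 : ∀ i j, ∫ p, D p i j ∂μ = (1 : Matrix ι ι ℂ) i j) :
    ∃ E : OperatorMeasure Ω K, ∀ S, MeasurableSet S → ∀ i j,
      inner ℂ (e i) (E S (e j)) = ∫ p in S, D p i j ∂μ := by
  classical
  -- The bound by `1` on `S` is positivity on the complement of `S`.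
  have hcompl : ∀ S, MeasurableSet S → (1 - Matrix.of fun i j => ∫ p in S, D p i j ∂μ) =
      Matrix.of fun i j => ∫ p in Sᶜ, D p i j ∂μ := by
    intro S hS
    ext i j
    rw [Matrix.sub_apply, ← h1, Matrix.of_apply, Matrix.of_apply, sub_eq_iff_eq_add',
      integral_add_compl hS (hint i j)]
  have hex : ∀ S, ∃ T : K →L[ℂ] K, MeasurableSet S → T.IsPositive ∧ (1 - T).IsPositive ∧
      ∀ i j, inner ℂ (e i) (T (e j)) = ∫ p in S, D p i j ∂μ := by
    intro S
    by_cases hS : MeasurableSet S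
    · obtain ⟨T, hT, hTe⟩ := exists_operator_of_posSemidef e (posSemidef_setIntegral hD hint S)
        (by rw [hcompl S hS]; exact posSemidef_setIntegral hD hint Sᶜ)
      obtain ⟨T', hT', hTe'⟩ := exists_operator_of_posSemidef e (posSemidef_setIntegral hD hint Sᶜ)
        (by rw [hcompl _ hS.compl]; exact posSemidef_setIntegral hD hint _)
      refine ⟨T, fun _ => ⟨hT, ?_, hTe⟩⟩
      convert hT'
      refine ext_of_inner_basis e fun i j => ?_
      rw [hTe', ← hcompl S hS]
      simp [hTe, orthonormal_iff_ite.1 e.orthonormal, Matrix.one_apply]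
    · exact ⟨0, fun h => absurd h hS⟩
  choose T hT using hex
  refine ⟨⟨fun S => if MeasurableSet S then T S else 0, fun X hX => if_neg hX, fun X hX => ?_, ?_,
    fun X hX hd φ ψ => ?_⟩, fun S hS i j => ?_⟩
  · rw [if_pos hX]; exact (hT X hX).1
  · rw [if_pos MeasurableSet.univ]
    refine ext_of_inner_basis e fun i j => ?_
    rw [(hT _ MeasurableSet.univ).2.2, setIntegral_univ, h1]
    simp [orthonormal_iff_ite.1 e.orthonormal, Matrix.one_apply]
  · simp only [hX, MeasurableSet.iUnion hX, if_true]
    have hfin : ∀ F : Finset ℕ, ∑ i ∈ F, T (X i) = T (⋃ i ∈ F, X i) := by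
      intro F
      refine ext_of_inner_basis e fun i j => ?_
      rw [(hT _ (F.measurableSet_biUnion fun i _ => hX i)).2.2, sum_apply, inner_sum,
        integral_biUnion_finset F (fun i _ => hX i) (fun a _ b _ hab => hd hab)
          (fun k _ => (hint i j).integrableOn)]
      exact Finset.sum_congr rfl fun k _ => (hT _ (hX k)).2.2 i j
    -- Finite unions give contractions, so convergence of the matrix elements is enough.
    have key := tendsto_inner_of_forall_basis e (fun F : Finset ℕ => ∑ i ∈ F, T (X i))
      (T (⋃ i, X i)) (l := atTop) (C := 1) (Eventually.of_forall fun F => by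
        have h := hT _ (F.measurableSet_biUnion fun i _ => hX i)
        rw [hfin]
        exact norm_le_one_of_isPositive h.1 h.2.1) ?_ φ ψ
    · simpa only [HasSum, SummationFilter.unconditional_filter, sum_apply, inner_sum] using key
    · intro i j
      have hs := hasSum_integral_iUnion (μ := μ) hX hd (hint i j).integrableOn
      rw [(hT _ (MeasurableSet.iUnion hX)).2.2]
      simpa only [HasSum, SummationFilter.unconditional_filter, sum_apply, inner_sum,
        (hT _ (hX _)).2.2] using hs
  · change inner ℂ (e i) ((if MeasurableSet S then T S else 0) (e j)) = _
    rw [if_pos hS, (hT S hS).2.2]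

end Density

namespace OperatorMeasure

variable {Ω : Type*} [MeasurableSpace Ω] {Ω' : Type*} [MeasurableSpace Ω']
  {K : Type*} [NormedAddCommGroup K] [InnerProductSpace ℂ K]

theorem ext_of_measurableSet {E E' : OperatorMeasure Ω K}
    (h : ∀ X, MeasurableSet X → E X = E' X) : E = E' := by
  have h' : E.toFun = E'.toFun := by
    funext X
    by_cases hX : MeasurableSet X
    · exact h X hX
    · rw [E.not_measurable X hX, E'.not_measurable X hX]
  cases E; cases E'; simpa using h'

theorem ext_of_distribution {E E' : OperatorMeasure Ω K}
    (h : ∀ ψ, E.distribution ψ = E'.distribution ψ) : E = E' := by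
  refine ext_of_measurableSet fun X hX => ContinuousLinearMap.coe_injective ?_
  rw [← ext_inner_map]
  intro ψ
  have h1 : inner ℂ ψ (E X ψ) = inner ℂ ψ (E' X ψ) := by
    rw [← distribution_real E ψ hX, ← distribution_real E' ψ hX, h]
  have h2 := congrArg (starRingEnd ℂ) h1
  rwa [inner_conj_symm, inner_conj_symm] at h2

theorem isPositive_one_sub [CompleteSpace K] (E : OperatorMeasure Ω K) {X : Set Ω}
    (hX : MeasurableSet X) : (1 - E X).IsPositive := by
  refine isPositive_of_inner_nonneg fun φ => ?_
  have h1 := E.distribution_real φ hX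
  have h2 := E.distribution_real φ MeasurableSet.univ
  have h3 : (E.distribution φ).real X ≤ (E.distribution φ).real Set.univ :=
    measureReal_mono (Set.subset_univ _)
  rw [E.univ] at h2
  simp only [sub_apply, one_apply_eq_self, inner_sub_right]
  rw [sub_nonneg, ← h1]
  refine le_trans (Complex.real_le_real.2 h3) (le_of_eq ?_)
  simpa using h2

theorem norm_apply_le_one [CompleteSpace K] (E : OperatorMeasure Ω K) {X : Set Ω}
    (hX : MeasurableSet X) : ‖E X‖ ≤ 1 :=
  norm_le_one_of_isPositive (E.nonneg X hX) (E.isPositive_one_sub hX)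

theorem distribution_real_univ (E : OperatorMeasure Ω K) (ψ : K) :
    (E.distribution ψ).real Set.univ = ‖ψ‖ ^ 2 := by
  have h := E.distribution_real ψ MeasurableSet.univ
  rw [E.univ, ContinuousLinearMap.id_apply, inner_self_eq_norm_sq_to_K,
    ← RCLike.ofReal_pow] at h
  exact Complex.ofReal_injective h

theorem isProbabilityMeasure_distribution (E : OperatorMeasure Ω K) {ψ : K} (hψ : ‖ψ‖ = 1) :
    IsProbabilityMeasure (E.distribution ψ) := by
  have h := E.distribution_real_univ ψ
  rw [hψ, one_pow, Measure.real, ENNReal.toReal_eq_one_iff] at h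
  exact ⟨h⟩

theorem distribution_map (E : OperatorMeasure Ω K) {f : Ω → Ω'} (hf : Measurable f) (ψ : K) :
    (E.map f hf).distribution ψ = (E.distribution ψ).map f := by
  ext X hX
  rw [Measure.map_apply hf hX, distribution_apply _ _ hX, distribution_apply _ _ (hf hX)]
  have : (E.map f hf) X = E (f ⁻¹' X) := if_pos hX
  rw [this]

/-- Vectors that are close in norm have distributions that are close in total variation. -/
theorem abs_distribution_real_sub_le [CompleteSpace K] (E : OperatorMeasure Ω K) (φ ψ : K)
    {X : Set Ω} (hX : MeasurableSet X) :
    |(E.distribution φ).real X - (E.distribution ψ).real X| ≤ ‖φ - ψ‖ * (‖φ‖ + ‖ψ‖) := by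
  have h : (((E.distribution φ).real X - (E.distribution ψ).real X : ℝ) : ℂ) =
      inner ℂ φ (E X (φ - ψ)) + inner ℂ (φ - ψ) (E X ψ) := by
    push_cast
    rw [E.distribution_real φ hX, E.distribution_real ψ hX, map_sub, inner_sub_right,
      inner_sub_left]
    ring
  have hb : ∀ χ, ‖E X χ‖ ≤ ‖χ‖ := fun χ => by
    simpa using (E X).le_of_opNorm_le (E.norm_apply_le_one hX) χ
  rw [← Real.norm_eq_abs, ← Complex.norm_real, h]
  calc _ ≤ ‖φ‖ * ‖E X (φ - ψ)‖ + ‖φ - ψ‖ * ‖E X ψ‖ :=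
        (norm_add_le _ _).trans (add_le_add (norm_inner_le_norm _ _) (norm_inner_le_norm _ _))
    _ ≤ ‖φ‖ * ‖φ - ψ‖ + ‖φ - ψ‖ * ‖ψ‖ := by gcongr <;> exact hb _
    _ = _ := by ring

end OperatorMeasure

/-- If two finite measures differ by at most `δ` on every measurable set, then the integrals of a
function bounded by `C` differ by at most `2Cδ`: split along a Hahn decomposition. -/
theorem norm_integral_sub_integral_le {Ω : Type*} [MeasurableSpace Ω] {μ ν : Measure Ω}
    [IsFiniteMeasure μ] [IsFiniteMeasure ν] {δ : ℝ}
    (h : ∀ X, MeasurableSet X → |μ.real X - ν.real X| ≤ δ) {f : Ω → ℂ} (hf : Measurable f) {C : ℝ}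
    (hC0 : 0 ≤ C) (hC : ∀ x, ‖f x‖ ≤ C) : ‖∫ x, f x ∂μ - ∫ x, f x ∂ν‖ ≤ 2 * C * δ := by
  have hint : ∀ (κ : Measure Ω) [IsFiniteMeasure κ], Integrable f κ := fun κ _ =>
    Integrable.of_bound hf.aestronglyMeasurable C (Eventually.of_forall hC)
  -- On a set where `ν ≤ μ`, the difference `μ - ν` is a measure of mass at most `δ`.
  have main : ∀ (μ ν : Measure Ω) [IsFiniteMeasure μ] [IsFiniteMeasure ν],
      (∀ X, MeasurableSet X → |μ.real X - ν.real X| ≤ δ) → ∀ s, MeasurableSet s →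
      (∀ t, MeasurableSet t → t ⊆ s → ν t ≤ μ t) →
      ‖∫ x in s, f x ∂μ - ∫ x in s, f x ∂ν‖ ≤ C * δ := by
    intro μ ν _ _ h s hs hle
    have hle' : ν.restrict s ≤ μ.restrict s := by
      refine Measure.le_iff.2 fun t ht => ?_
      rw [Measure.restrict_apply ht, Measure.restrict_apply ht]
      exact hle _ (ht.inter hs) Set.inter_subset_right
    have hadd := Measure.sub_add_cancel_of_le hle'
    set κ := μ.restrict s - ν.restrict s with hκ
    have hκle : κ ≤ μ.restrict s := by
      rw [← hadd]; exact Measure.le_add_right le_rfl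
    have : IsFiniteMeasure κ := isFiniteMeasure_of_le _ hκle
    have hmass : κ.real Set.univ = μ.real s - ν.real s := by
      have := congrArg (fun m : Measure Ω => m.real Set.univ) hadd
      simp only [measureReal_restrict_apply MeasurableSet.univ, Set.univ_inter] at this
      rw [measureReal_add_apply, measureReal_restrict_apply MeasurableSet.univ,
        Set.univ_inter] at this
      linarith
    rw [← hadd, integral_add_measure (hint _) (hint _), add_sub_cancel_right]
    have hκδ : κ.real Set.univ ≤ δ := hmass.le.trans ((le_abs_self _).trans (h s hs))
    refine (norm_integral_le_of_norm_le_const (Eventually.of_forall hC)).trans ?_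
    gcongr
  obtain ⟨s, hs, h1, h2⟩ := hahn_decomposition μ ν
  have e1 := main μ ν h s hs h1
  have e2 := main ν μ (fun X hX => by rw [abs_sub_comm]; exact h X hX) sᶜ hs.compl h2
  rw [← integral_add_compl hs (hint μ), ← integral_add_compl hs (hint ν)]
  calc _ = ‖(∫ x in s, f x ∂μ - ∫ x in s, f x ∂ν) -
        (∫ x in sᶜ, f x ∂ν - ∫ x in sᶜ, f x ∂μ)‖ := by congr 1; ring
    _ ≤ C * δ + C * δ := (norm_sub_le _ _).trans (add_le_add e1 e2)
    _ = _ := by ring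

/-! ### The phase matrix and the product of two phase observables -/

/-- A continuous function on the circle whose integral over every Borel set is a nonnegative real is
everywhere nonnegative, since the Haar measure has full support. -/
theorem nonneg_of_forall_setIntegral_nonneg {f : Phase → ℂ} (hf : Continuous f)
    (h : ∀ X, MeasurableSet X → 0 ≤ ∫ θ in X, f θ ∂AddCircle.haarAddCircle) (θ : Phase) :
    0 ≤ f θ := by
  have hint : Integrable f AddCircle.haarAddCircle :=
    hf.integrable_of_hasCompactSupport (HasCompactSupport.of_compactSpace f)
  have real : ∀ g : Phase → ℝ, Continuous g →
      (∀ X, MeasurableSet X → 0 ≤ ∫ θ in X, g θ ∂AddCircle.haarAddCircle) → ∀ θ, 0 ≤ g θ := by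
    intro g hg h θ
    have hgint : Integrable g AddCircle.haarAddCircle :=
      hg.integrable_of_hasCompactSupport (HasCompactSupport.of_compactSpace g)
    have hae := ae_nonneg_of_forall_setIntegral_nonneg hgint fun s hs _ => h s hs
    have hmax : (fun θ => max (g θ) 0) =ᵐ[AddCircle.haarAddCircle] g := by
      filter_upwards [hae] with θ hθ using max_eq_left hθ
    have := (Continuous.ae_eq_iff_eq _ (hg.max continuous_const) hg).1 hmax
    exact max_eq_left_iff.1 (congrFun this θ)
  have hre : ∀ X : Set Phase, ∫ θ in X, (f θ).re ∂AddCircle.haarAddCircle =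
      (∫ θ in X, f θ ∂AddCircle.haarAddCircle).re := fun X => integral_re hint.integrableOn
  have him : ∀ X : Set Phase, ∫ θ in X, (f θ).im ∂AddCircle.haarAddCircle =
      (∫ θ in X, f θ ∂AddCircle.haarAddCircle).im := fun X => integral_im hint.integrableOn
  rw [Complex.nonneg_iff]
  refine ⟨real (fun θ => (f θ).re) (by fun_prop) (fun X hX => ?_) θ, le_antisymm ?_ ?_⟩
  · rw [hre]; exact (Complex.nonneg_iff.1 (h X hX)).1
  · refine real (fun θ => (f θ).im) (by fun_prop) (fun X hX => ?_) θ
    rw [him]; exact (Complex.nonneg_iff.1 (h X hX)).2.le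
  · refine neg_nonneg.1 (real (fun θ => -(f θ).im) (by fun_prop) (fun X hX => ?_) θ)
    rw [integral_neg, him, neg_nonneg]; exact (Complex.nonneg_iff.1 (h X hX)).2.ge

section PhaseMatrix

variable {H : Type*} [NormedAddCommGroup H] [InnerProductSpace ℂ H]

/-- The matrix-valued density `θ ↦ (cₙₘ e^{i(n-m)θ})` of a phase observable with phase matrix
`(cₙₘ)`, with respect to the normalized Haar measure of the circle. -/
def phaseDensity (c : ℕ → ℕ → ℂ) (θ : Phase) : Matrix ℕ ℕ ℂ :=
  Matrix.of fun n m => c n m * fourier ((n : ℤ) - (m : ℤ)) θ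

@[fun_prop]
theorem continuous_phaseDensity (c : ℕ → ℕ → ℂ) (n m : ℕ) :
    Continuous fun θ => phaseDensity c θ n m :=
  continuous_const.mul (map_continuous _)

theorem integrable_phaseDensity (c : ℕ → ℕ → ℂ) (n m : ℕ) :
    Integrable (fun θ => phaseDensity c θ n m) AddCircle.haarAddCircle :=
  (continuous_phaseDensity c n m).integrable_of_hasCompactSupport
    (HasCompactSupport.of_compactSpace _)

variable {b : HilbertBasis ℕ ℂ H} {E : OperatorMeasure Phase H} {c : ℕ → ℕ → ℂ}

theorem IsPhaseMatrix.setIntegral_phaseDensity (hc : IsPhaseMatrix b E c) {X : Set Phase}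
    (hX : MeasurableSet X) (n m : ℕ) :
    ∫ θ in X, phaseDensity c θ n m ∂AddCircle.haarAddCircle = inner ℂ (b n) (E X (b m)) := by
  rw [hc X hX]; exact integral_const_mul _ _

theorem IsPhaseMatrix.setIntegral_sum_phaseDensity (hc : IsPhaseMatrix b E c) {X : Set Phase}
    (hX : MeasurableSet X) (F : Finset ℕ) (u : ℕ → ℂ) :
    ∫ θ in X, ∑ i ∈ F, ∑ j ∈ F, (starRingEnd ℂ) (u i) * phaseDensity c θ i j * u j
        ∂AddCircle.haarAddCircle =
      inner ℂ (∑ i ∈ F, u i • b i) (E X (∑ i ∈ F, u i • b i)) := by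
  have hint : ∀ i j, IntegrableOn
      (fun θ => (starRingEnd ℂ) (u i) * phaseDensity c θ i j * u j) X AddCircle.haarAddCircle :=
    fun i j => ((integrable_phaseDensity c i j).integrableOn.const_mul _).mul_const _
  rw [integral_finsetSum _ fun i _ => integrable_finsetSum _ fun j _ => hint i j, sum_inner]
  refine Finset.sum_congr rfl fun i _ => ?_
  rw [integral_finsetSum _ fun j _ => hint i j, map_sum, inner_sum]
  refine Finset.sum_congr rfl fun j _ => ?_
  rw [integral_mul_const, integral_const_mul, hc.setIntegral_phaseDensity hX, map_smul,
    inner_smul_left, inner_smul_right]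
  ring

/-- Positivity of all `E(X)` forces the continuous density of `E` to be positive at every point. -/
theorem IsPhaseMatrix.posSemidef_phaseDensity (hc : IsPhaseMatrix b E c) (θ : Phase) :
    (phaseDensity c θ).PosSemidef := by
  refine ⟨?_, fun x => ?_⟩
  · have hz : ∀ n m, ∀ X, MeasurableSet X → ∫ θ in X, (phaseDensity c θ n m -
        (starRingEnd ℂ) (phaseDensity c θ m n)) ∂AddCircle.haarAddCircle = 0 := by
      intro n m X hX
      have hconj : Integrable (fun θ => (starRingEnd ℂ) (phaseDensity c θ m n))
          AddCircle.haarAddCircle :=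
        Complex.conjCLE.toContinuousLinearMap.integrable_comp (integrable_phaseDensity c m n)
      rw [integral_sub (integrable_phaseDensity c n m).integrableOn hconj.integrableOn,
        integral_conj, hc.setIntegral_phaseDensity hX, hc.setIntegral_phaseDensity hX,
        inner_conj_symm, (E.nonneg X hX).inner_left_eq_inner_right, sub_self]
    have hcont : ∀ n m, Continuous fun θ => phaseDensity c θ n m -
        (starRingEnd ℂ) (phaseDensity c θ m n) := fun n m =>
      (continuous_phaseDensity c n m).sub
        (Complex.continuous_conj.comp (continuous_phaseDensity c m n))
    ext n m
    rw [Matrix.conjTranspose_apply, eq_comm, Complex.star_def, ← sub_eq_zero]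
    refine le_antisymm (neg_nonneg.1 ?_) ?_
    · exact nonneg_of_forall_setIntegral_nonneg (hcont n m).neg
        (fun X hX => by simp only [Pi.neg_apply, integral_neg, hz n m X hX, neg_zero, le_refl]) θ
    · exact nonneg_of_forall_setIntegral_nonneg (hcont n m)
        (fun X hX => by rw [hz n m X hX]) θ
  · refine nonneg_of_forall_setIntegral_nonneg (f := fun θ => x.sum fun i xi => x.sum fun j xj =>
      star xi * phaseDensity c θ i j * xj) ?_ (fun X hX => ?_) θ
    · simp only [Finsupp.sum]
      fun_prop
    · simp only [Finsupp.sum]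
      exact (hc.setIntegral_sum_phaseDensity hX x.support x).symm ▸
        (E.nonneg X hX).inner_nonneg_right _

end PhaseMatrix

section Product

variable {H : Type*} [NormedAddCommGroup H] [InnerProductSpace ℂ H]

theorem inner_elem (φ ψ φ' ψ' : H) :
    inner ℂ (elem φ ψ) (elem φ' ψ') = inner ℂ φ φ' * inner ℂ ψ ψ' := by
  rw [elem, elem, UniformSpace.Completion.inner_coe, TensorProduct.inner_tmul]

theorem norm_elem (φ ψ : H) : ‖elem φ ψ‖ = ‖φ‖ * ‖ψ‖ := by
  rw [elem, UniformSpace.Completion.norm_coe, TensorProduct.norm_tmul]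

theorem orthonormal_elem (b : HilbertBasis ℕ ℂ H) :
    Orthonormal ℂ (fun p : ℕ × ℕ => elem (b p.1) (b p.2)) := by
  classical
  rw [orthonormal_iff_ite]
  intro p q
  simp only [inner_elem, orthonormal_iff_ite.1 b.orthonormal, Prod.ext_iff]
  split_ifs <;> simp_all

/-- A vector orthogonal to all `|n⟩ ⊗ |k⟩` is, one tensor factor at a time, orthogonal to all
elementary tensors. -/
theorem orthogonal_span_elem_eq_bot (b : HilbertBasis ℕ ℂ H) :
    (Submodule.span ℂ (Set.range fun p : ℕ × ℕ => elem (b p.1) (b p.2)))ᗮ = ⊥ := by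
  rw [Submodule.eq_bot_iff]
  intro v hv
  have hdense : Dense (Submodule.span ℂ (Set.range b) : Set H) :=
    (Submodule.dense_iff_topologicalClosure_eq_top).2 b.dense_span
  let L : H → H →L[ℂ] ℂ := fun φ => (innerSL ℂ v).comp
    ((UniformSpace.Completion.toComplL (𝕜 := ℂ) (E := H ⊗[ℂ] H)).comp (TensorProduct.mkL ℂ H H φ))
  let L' : H → H →L[ℂ] ℂ := fun ψ => (innerSL ℂ v).comp
    ((UniformSpace.Completion.toComplL (𝕜 := ℂ) (E := H ⊗[ℂ] H)).comp
      ((TensorProduct.mkL ℂ H H).flip ψ))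
  have hL : ∀ φ ψ, L φ ψ = inner ℂ v (elem φ ψ) := fun φ ψ => rfl
  have hL' : ∀ φ ψ, L' ψ φ = inner ℂ v (elem φ ψ) := fun φ ψ => rfl
  have h0 : ∀ n m, inner ℂ v (elem (b n) (b m)) = 0 := fun n m =>
    (Submodule.mem_orthogonal' _ _).1 hv _ (Submodule.subset_span ⟨(n, m), rfl⟩)
  have h1 : ∀ n, L (b n) = 0 := fun n => ContinuousLinearMap.ext_on hdense (by
    rintro _ ⟨m, rfl⟩; rw [hL, h0]; rfl)
  have h2 : ∀ ψ, L' ψ = 0 := fun ψ => ContinuousLinearMap.ext_on hdense (by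
    rintro _ ⟨n, rfl⟩; rw [hL', ← hL, h1]; rfl)
  have h3 : ∀ t : H ⊗[ℂ] H, inner ℂ v (t : TwoMode H) = 0 := by
    intro t
    induction t using TensorProduct.induction_on with
    | zero => exact (congrArg _ UniformSpace.Completion.coe_zero).trans (inner_zero_right v)
    | tmul φ ψ => exact (hL' φ ψ).symm.trans (by rw [h2]; rfl)
    | add s t hs ht => rw [UniformSpace.Completion.coe_add, inner_add_right, hs, ht, add_zero]
  have h4 : ∀ w : TwoMode H, inner ℂ v w = 0 := fun w =>
    UniformSpace.Completion.induction_on w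
      (isClosed_eq (continuous_const.inner continuous_id) continuous_const) h3
  exact inner_self_eq_zero.1 (h4 v)

/-- The Hilbert basis `|n⟩ ⊗ |k⟩` of the two-mode space. -/
def twoModeBasis (b : HilbertBasis ℕ ℂ H) : HilbertBasis (ℕ × ℕ) ℂ (TwoMode H) :=
  HilbertBasis.mkOfOrthogonalEqBot (orthonormal_elem b) (orthogonal_span_elem_eq_bot b)

theorem twoModeBasis_apply (b : HilbertBasis ℕ ℂ H) (p : ℕ × ℕ) :
    twoModeBasis b p = elem (b p.1) (b p.2) := by
  rw [twoModeBasis, HilbertBasis.coe_mkOfOrthogonalEqBot]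

/-- The product of two phase observables has as density the Schur product of their densities. -/
theorem exists_isProduct {b : HilbertBasis ℕ ℂ H} {E₁ E₂ : OperatorMeasure Phase H}
    {c₁ c₂ : ℕ → ℕ → ℂ} (hc₁ : IsPhaseMatrix b E₁ c₁) (hc₂ : IsPhaseMatrix b E₂ c₂) :
    ∃ Et : OperatorMeasure (Phase × Phase) (TwoMode H), IsProduct E₁ E₂ Et := by
  classical
  let D : Phase × Phase → Matrix (ℕ × ℕ) (ℕ × ℕ) ℂ := fun p =>
    Matrix.of fun i j => phaseDensity c₁ p.1 i.1 j.1 * phaseDensity c₂ p.2 i.2 j.2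
  have hrect : ∀ X Y : Set Phase, MeasurableSet X → MeasurableSet Y → ∀ i j : ℕ × ℕ,
      ∫ p in X ×ˢ Y, D p i j ∂(AddCircle.haarAddCircle.prod AddCircle.haarAddCircle) =
        inner ℂ (b i.1) (E₁ X (b j.1)) * inner ℂ (b i.2) (E₂ Y (b j.2)) := by
    intro X Y hX hY i j
    rw [← hc₁.setIntegral_phaseDensity hX, ← hc₂.setIntegral_phaseDensity hY]
    exact setIntegral_prod_mul (fun x => phaseDensity c₁ x i.1 j.1)
      (fun y => phaseDensity c₂ y i.2 j.2) X Y
  obtain ⟨Et, hEt⟩ := exists_operatorMeasure_of_density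
    (μ := AddCircle.haarAddCircle.prod AddCircle.haarAddCircle) (twoModeBasis b) (D := D)
    (fun p => ((hc₁.posSemidef_phaseDensity p.1).submatrix Prod.fst).hadamard
      ((hc₂.posSemidef_phaseDensity p.2).submatrix Prod.snd))
    (fun i j => (integrable_phaseDensity c₁ i.1 j.1).mul_prod (integrable_phaseDensity c₂ i.2 j.2))
    (fun i j => by
      rw [← setIntegral_univ, ← Set.univ_prod_univ, hrect _ _ .univ .univ, E₁.univ, E₂.univ]
      simp only [ContinuousLinearMap.id_apply, ← inner_elem, ← twoModeBasis_apply]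
      exact orthonormal_iff_ite.1 (twoModeBasis b).orthonormal i j)
  refine ⟨Et, fun X Y hX hY => ext_of_inner_basis (twoModeBasis b) fun i j => ?_⟩
  rw [hEt _ (hX.prod hY), hrect X Y hX hY, twoModeBasis_apply, twoModeBasis_apply, tensorOp_elem,
    inner_elem]

theorem IsProduct.unique {E₁ E₂ : OperatorMeasure Phase H}
    {Et Et' : OperatorMeasure (Phase × Phase) (TwoMode H)} (h : IsProduct E₁ E₂ Et)
    (h' : IsProduct E₁ E₂ Et') : Et = Et' := by
  refine OperatorMeasure.ext_of_distribution fun ψ => ?_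
  refine Measure.ext_prod fun {X Y} hX hY => ?_
  rw [OperatorMeasure.distribution_apply _ _ (hX.prod hY),
    OperatorMeasure.distribution_apply _ _ (hX.prod hY), h X Y hX hY, h' X Y hX hY]

/-- In a product state the outcomes of the two observables are independent. -/
theorem IsProduct.distribution_elem {E₁ E₂ : OperatorMeasure Phase H}
    {Et : OperatorMeasure (Phase × Phase) (TwoMode H)} (h : IsProduct E₁ E₂ Et) (φ ψ : H) :
    Et.distribution (elem φ ψ) = (E₁.distribution φ).prod (E₂.distribution ψ) := by
  refine (Measure.prod_eq fun X Y hX hY => ?_).symm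
  have hre : 0 ≤ (inner ℂ φ (E₁ X φ)).re := (E₁.nonneg X hX).re_inner_nonneg_right φ
  rw [OperatorMeasure.distribution_apply _ _ (hX.prod hY),
    OperatorMeasure.distribution_apply _ _ hX, OperatorMeasure.distribution_apply _ _ hY,
    h X Y hX hY, tensorOp_elem, inner_elem, ← ENNReal.ofReal_mul hre,
    ← OperatorMeasure.distribution_real E₁ φ hX, ← OperatorMeasure.distribution_real E₂ ψ hY]
  simp

end Product

/-! ### Fourier coefficients of the phase distributions -/

/-- The density may be complex-valued as long as its values are nonnegative reals. -/
theorem integral_eq_integral_density_mul {Ω : Type*} [MeasurableSpace Ω] {μ ν : Measure Ω}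
    [IsFiniteMeasure μ] {ρ : Ω → ℂ} (hm : Measurable ρ) (hint : Integrable ρ ν)
    (h0 : ∀ x, 0 ≤ ρ x) (h : ∀ X, MeasurableSet X → (μ.real X : ℂ) = ∫ x in X, ρ x ∂ν)
    (g : Ω → ℂ) : ∫ x, g x ∂μ = ∫ x, ρ x * g x ∂ν := by
  have hre : ∀ x, ((ρ x).re : ℂ) = ρ x := fun x =>
    Complex.ext rfl (by simpa using (Complex.nonneg_iff.1 (h0 x)).2)
  have h0' : ∀ x, 0 ≤ (ρ x).re := fun x => (Complex.nonneg_iff.1 (h0 x)).1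
  have hint' : Integrable (fun x => (ρ x).re) ν := hint.re
  have hμ : μ = ν.withDensity fun x => ENNReal.ofReal (ρ x).re := by
    ext X hX
    rw [withDensity_apply _ hX, ← ofReal_integral_eq_lintegral_ofReal hint'.integrableOn
      (Eventually.of_forall h0')]
    have h1 : ∫ x in X, (ρ x).re ∂ν = μ.real X := by
      have := congrArg Complex.re (h X hX)
      rw [Complex.ofReal_re] at this
      rw [this]
      exact integral_re hint.integrableOn
    rw [h1, ofReal_measureReal]
  rw [hμ, integral_withDensity_eq_integral_toReal_smul (by fun_prop)
    (Eventually.of_forall fun x => ENNReal.ofReal_lt_top)]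
  refine integral_congr_ae (Eventually.of_forall fun x => ?_)
  simp only [ENNReal.toReal_ofReal (h0' x), Complex.real_smul, hre]

theorem norm_fourier_apply (n : ℤ) (x : Phase) : ‖fourier n x‖ = 1 := by
  rw [fourier_apply]; exact Circle.norm_coe _

theorem integral_fourier (q : ℤ) :
    ∫ θ : Phase, fourier q θ ∂AddCircle.haarAddCircle = if q = 0 then 1 else 0 := by
  have h := congrFun (fourierCoeff_fourier (T := 2 * Real.pi) q) 0
  simp only [fourierCoeff, neg_zero, fourier_zero, one_smul] at h
  rw [h, Pi.single_apply]
  simp [eq_comm]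

section

variable {H : Type*} [NormedAddCommGroup H] [InnerProductSpace ℂ H]
  {b : HilbertBasis ℕ ℂ H} {E : OperatorMeasure Phase H} {c : ℕ → ℕ → ℂ}

/-- For a finite superposition of number states the distribution has a trigonometric polynomial as
density, and orthogonality of the characters leaves the `k`-th diagonal of the phase matrix. -/
theorem IsPhaseMatrix.integral_fourier_distribution_sum (hc : IsPhaseMatrix b E c)
    (u : ℕ → ℂ) (k N : ℕ) :
    ∫ x, fourier (k : ℤ) x ∂(E.distribution (∑ i ∈ Finset.range (N + k), u i • b i)) =
      ∑ n ∈ Finset.range N, (starRingEnd ℂ) (u n) * u (n + k) * c n (n + k) := by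
  set F := Finset.range (N + k) with hF
  have hcont : Continuous fun θ => ∑ i ∈ F, ∑ j ∈ F,
      (starRingEnd ℂ) (u i) * phaseDensity c θ i j * u j := by fun_prop
  have hterm : ∀ i j, ∫ θ : Phase, (starRingEnd ℂ) (u i) * phaseDensity c θ i j * u j *
      fourier (k : ℤ) θ ∂AddCircle.haarAddCircle =
        if j = i + k then (starRingEnd ℂ) (u i) * u j * c i j else 0 := by
    intro i j
    have : ∀ θ : Phase, (starRingEnd ℂ) (u i) * phaseDensity c θ i j * u j *
        fourier (k : ℤ) θ =
        (starRingEnd ℂ) (u i) * u j * c i j * fourier ((i : ℤ) - j + k) θ := fun θ => by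
      rw [fourier_add, phaseDensity, Matrix.of_apply]; ring
    refine (integral_congr_ae (Eventually.of_forall this)).trans ?_
    refine (integral_const_mul _ _).trans ?_
    rw [integral_fourier]
    have hiff : (i : ℤ) - j + k = 0 ↔ j = i + k := by omega
    simp only [hiff, mul_ite, mul_one, mul_zero]
  have hint : ∀ i j, Integrable (fun θ : Phase => (starRingEnd ℂ) (u i) * phaseDensity c θ i j *
      u j * fourier (k : ℤ) θ) AddCircle.haarAddCircle := fun i j =>
    Continuous.integrable_of_hasCompactSupport
      (((continuous_const.mul (continuous_phaseDensity c i j)).mul continuous_const).mul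
        (map_continuous _)) (HasCompactSupport.of_compactSpace _)
  rw [integral_eq_integral_density_mul hcont.measurable
    (hcont.integrable_of_hasCompactSupport (HasCompactSupport.of_compactSpace _))
    (fun θ => (hc.posSemidef_phaseDensity θ).finset_sum_nonneg F u)
    (fun X hX => by
      rw [hc.setIntegral_sum_phaseDensity hX, OperatorMeasure.distribution_real E _ hX])]
  simp only [Finset.sum_mul]
  rw [integral_finsetSum _ fun i _ => integrable_finsetSum _ fun j _ => hint i j]
  simp only [integral_finsetSum _ fun j _ => hint _ j, hterm, Finset.sum_ite_eq']
  rw [← Finset.sum_filter]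
  refine Finset.sum_congr ?_ fun _ _ => rfl
  ext i
  simp only [hF, Finset.mem_filter, Finset.mem_range]
  omega

/-- The Fourier coefficients of the distribution of a phase observable are given by the diagonals
of its phase matrix: the partial sums belong to truncated states, whose distributions converge in
total variation. -/
theorem IsPhaseMatrix.tendsto_integral_fourier_distribution [CompleteSpace H]
    (hc : IsPhaseMatrix b E c) (ψ : H) (k : ℕ) :
    Tendsto (fun N => ∑ n ∈ Finset.range N, (starRingEnd ℂ) (inner ℂ (b n) ψ) *
        inner ℂ (b (n + k)) ψ * c n (n + k)) atTop
      (𝓝 (∫ x, fourier (k : ℤ) x ∂(E.distribution ψ))) := by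
  let ψN : ℕ → H := fun N => ∑ i ∈ Finset.range (N + k), inner ℂ (b i) ψ • b i
  have hψN : Tendsto ψN atTop (𝓝 ψ) := by
    have h := (b.hasSum_repr ψ).tendsto_sum_nat.comp (tendsto_add_atTop_nat k)
    simpa only [Function.comp_def, b.repr_apply_apply] using h
  have hb : Tendsto (fun N => 2 * 1 * (‖ψN N - ψ‖ * (‖ψN N‖ + ‖ψ‖))) atTop (𝓝 0) := by
    have h1 : Tendsto (fun N => ‖ψN N - ψ‖) atTop (𝓝 0) := by
      simpa using (hψN.sub_const ψ).norm
    simpa using (h1.mul (hψN.norm.add_const ‖ψ‖)).const_mul (2 * 1 : ℝ)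
  have hlim : Tendsto (fun N => ∫ x, fourier (k : ℤ) x ∂(E.distribution (ψN N))) atTop
      (𝓝 (∫ x, fourier (k : ℤ) x ∂(E.distribution ψ))) := by
    rw [tendsto_iff_norm_sub_tendsto_zero]
    refine squeeze_zero (fun _ => norm_nonneg _) (fun N => ?_) hb
    exact norm_integral_sub_integral_le (fun X hX => E.abs_distribution_real_sub_le _ _ hX)
      (map_continuous (fourier (k : ℤ))).measurable zero_le_one
      fun x => (norm_fourier_apply _ x).le
  refine hlim.congr fun N => ?_
  exact hc.integral_fourier_distribution_sum (fun i => inner ℂ (b i) ψ) k N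

end

/-! ### Poisson weights -/

/-- A regular summation method: weighted means of a convergent sequence tend to its limit if the
weights are nonnegative, their total mass tends to `1` and every single weight tends to `0`. -/
theorem tendsto_tsum_weight_mul {J : Type*} {l : Filter J} {w : J → ℕ → ℝ}
    (h0 : ∀ᶠ j in l, ∀ n, 0 ≤ w j n) (hs : ∀ᶠ j in l, Summable (w j))
    (h1 : Tendsto (fun j => ∑' n, w j n) l (𝓝 1)) (hn : ∀ n, Tendsto (fun j => w j n) l (𝓝 0))
    {c : ℕ → ℂ} {L : ℂ} (hc : Tendsto c atTop (𝓝 L)) :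
    Tendsto (fun j => ∑' n, (w j n : ℂ) * c n) l (𝓝 L) := by
  obtain ⟨M, hM⟩ := (Metric.isBounded_range_of_tendsto _ (hc.sub_const L)).exists_norm_le
  have hM' : ∀ n, ‖c n - L‖ ≤ M := fun n => hM _ ⟨n, rfl⟩
  have hzero : Tendsto (fun j => ∑' n, (w j n : ℂ) * (c n - L)) l (𝓝 0) := by
    rw [Metric.tendsto_nhds]
    intro ε hε
    obtain ⟨N, hN⟩ := Metric.tendsto_atTop.1 hc (ε / 2) (by positivity)
    have hlim : Tendsto (fun j => ∑ n ∈ Finset.range N, w j n * M + ε / 2 * ∑' n, w j n) l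
        (𝓝 (ε / 2)) := by
      have := (tendsto_finsetSum (Finset.range N) fun n _ => (hn n).mul_const M).add
        (h1.const_mul (ε / 2))
      simpa using this
    filter_upwards [h0, hs, hlim.eventually_lt_const (by linarith : ε / 2 < ε)] with j hj0 hjs hj
    rw [dist_zero_right]
    refine lt_of_le_of_lt (tsum_of_norm_bounded
      (g := fun n => (if n ∈ Finset.range N then w j n * M else 0) + ε / 2 * w j n)
      (HasSum.add ?_ (hjs.hasSum.mul_left _)) fun n => ?_) hj
    · have := hasSum_sum_of_ne_finset_zero (L := .unconditional ℕ) (s := Finset.range N)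
        (f := fun n => if n ∈ Finset.range N then w j n * M else 0)
        (fun n hn => if_neg hn)
      rwa [Finset.sum_ite_mem, Finset.inter_self] at this
    · rw [norm_mul, Complex.norm_real, Real.norm_of_nonneg (hj0 n)]
      have hw := hj0 n
      split_ifs with hnN
      · have := mul_le_mul_of_nonneg_left (hM' n) hw
        nlinarith
      · have h2 : ‖c n - L‖ ≤ ε / 2 := by
          rw [← dist_eq_norm]
          exact (hN n (by simpa using hnN)).le
        nlinarith [mul_le_mul_of_nonneg_left h2 hw]
  have hL : Tendsto (fun j => ((∑' n, w j n : ℝ) : ℂ) * L) l (𝓝 L) := by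
    have := ((Complex.continuous_ofReal.tendsto 1).comp h1).mul_const L
    simpa using this
  have := hzero.add hL
  rw [zero_add] at this
  refine this.congr' ?_
  filter_upwards [h0, hs] with j hj0 hjs
  have hsC : Summable fun n => (w j n : ℂ) := Complex.ofRealCLM.summable hjs
  have hsd : Summable fun n => (w j n : ℂ) * (c n - L) := by
    refine Summable.of_norm_bounded (hjs.mul_right M) fun n => ?_
    rw [norm_mul, Complex.norm_real, Real.norm_of_nonneg (hj0 n)]
    exact mul_le_mul_of_nonneg_left (hM' n) (hj0 n)
  rw [Complex.ofReal_tsum, ← hsC.tsum_mul_right, ← hsd.tsum_add (hsC.mul_right L)]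
  exact tsum_congr fun n => by ring

/-- The modulus `e^{-r²/2} rⁿ / √(n!)` of the `n`-th amplitude of the coherent state `|z⟩` with
`|z| = r`; its square is the Poisson weight of mean `r²`. -/
def amplitude (r : ℝ) (n : ℕ) : ℝ :=
  Real.exp (-r ^ 2 / 2) * (r ^ n / Real.sqrt (Nat.factorial n))

theorem amplitude_nonneg {r : ℝ} (hr : 0 ≤ r) (n : ℕ) : 0 ≤ amplitude r n := by
  unfold amplitude; positivity

theorem amplitude_sq (r : ℝ) (n : ℕ) :
    amplitude r n ^ 2 = Real.exp (-r ^ 2) * (r ^ 2) ^ n / Nat.factorial n := by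
  rw [amplitude, mul_pow, div_pow, Real.sq_sqrt (by positivity), ← Real.exp_nat_mul, ← pow_mul,
    ← pow_mul, mul_comm n 2, mul_div_assoc]
  congr 2
  push_cast; ring

theorem hasSum_amplitude_sq (r : ℝ) : HasSum (fun n => amplitude r n ^ 2) 1 := by
  simp only [amplitude_sq]
  exact ProbabilityTheory.hasSum_one_poissonMeasure (⟨r ^ 2, sq_nonneg r⟩ : NNReal)

/-- The mean of the Poisson distribution. -/
theorem hasSum_mul_amplitude_sq (r : ℝ) :
    HasSum (fun n : ℕ => n * amplitude r n ^ 2) (r ^ 2) := by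
  rw [← hasSum_nat_add_iff' 1]
  have h := (hasSum_amplitude_sq r).mul_left (r ^ 2)
  simp only [Finset.range_one, Finset.sum_singleton, Nat.cast_zero, zero_mul, sub_zero]
  rw [mul_one] at h
  refine h.congr_fun fun n => ?_
  rw [amplitude_sq, amplitude_sq, Nat.factorial_succ]
  push_cast
  field_simp
  ring

theorem tendsto_amplitude (n : ℕ) : Tendsto (fun r => amplitude r n) atTop (𝓝 0) := by
  have h : Tendsto (fun r : ℝ => amplitude r n ^ 2) atTop (𝓝 0) := by
    have h1 := ((Real.tendsto_pow_mul_exp_neg_atTop_nhds_zero n).comp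
      (tendsto_pow_atTop (α := ℝ) two_ne_zero)).div_const (Nat.factorial n : ℝ)
    simpa [Function.comp_def, amplitude_sq, mul_comm] using h1
  have h2 := h.sqrt
  rw [Real.sqrt_zero] at h2
  refine h2.congr' ?_
  filter_upwards [eventually_ge_atTop 0] with r hr
  exact Real.sqrt_sq (amplitude_nonneg hr n)

theorem summable_amplitude_mul {r : ℝ} (hr : 0 ≤ r) (k : ℕ) :
    Summable fun n => amplitude r n * amplitude r (n + k) := by
  have h := (hasSum_amplitude_sq r).summable
  have hk : Summable fun n => amplitude r (n + k) ^ 2 := (summable_nat_add_iff k).2 h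
  refine Summable.of_nonneg_of_le
    (fun n => mul_nonneg (amplitude_nonneg hr _) (amplitude_nonneg hr _)) (fun n => ?_)
    (h.add hk)
  nlinarith [sq_nonneg (amplitude r n - amplitude r (n + k)), sq_nonneg (amplitude r n),
    sq_nonneg (amplitude r (n + k))]

/-- The ratio of two amplitudes is bounded below by the convexity of `t ↦ t^{-k/2}`, for
`t = (n + k) / r²`. -/
theorem amplitude_mul_ge {r : ℝ} (hr : 0 < r) {k : ℕ} (hk : 1 ≤ k) (n : ℕ) :
    amplitude r n ^ 2 * (1 - k / 2 * ((n + k) / r ^ 2 - 1)) ≤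
      amplitude r n * amplitude r (n + k) := by
  have ha := amplitude_nonneg hr.le n
  set t : ℝ := (n + k) / r ^ 2 with ht
  have hk0 : (0 : ℝ) < k := by exact_mod_cast hk
  have ht0 : 0 < t := by positivity
  set s : ℝ := Real.exp (-(k / 2 * Real.log t)) with hs
  -- Here `s = t ^ (-k / 2)`.
  have hs1 : 1 - k / 2 * (t - 1) ≤ s := by
    have h1 := Real.add_one_le_exp (-(k / 2 * Real.log t))
    have h2 := mul_le_mul_of_nonneg_left (Real.log_le_sub_one_of_pos ht0)
      (by positivity : (0 : ℝ) ≤ k / 2)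
    linarith
  have hs2 : s ^ 2 * t ^ k = 1 := by
    rw [hs, ← Real.exp_nat_mul, ← Real.exp_log (pow_pos ht0 k), Real.log_pow, ← Real.exp_add,
      Real.exp_eq_one_iff]
    push_cast; ring
  -- `(n + k)! / n! ≤ (n + k) ^ k` gives `amplitude r (n + k) ≥ amplitude r n * t ^ (-k / 2)`.
  have hfac : ((n + k).factorial : ℝ) ≤ n.factorial * (n + k : ℝ) ^ k := by
    rw [← Nat.factorial_mul_ascFactorial]
    push_cast
    gcongr
    exact_mod_cast Nat.ascFactorial_le_pow_add n k
  have hratio : (amplitude r n * s) ^ 2 ≤ amplitude r (n + k) ^ 2 := by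
    have hst : s ^ 2 = (r ^ 2) ^ k / (n + k : ℝ) ^ k := by
      rw [eq_div_iff (by positivity)]
      have : t ^ k * (r ^ 2) ^ k = (n + k : ℝ) ^ k := by
        rw [← mul_pow, ht]; field_simp
      rw [← this, ← mul_assoc, hs2, one_mul]
    rw [mul_pow, amplitude_sq, amplitude_sq, hst, pow_add, div_mul_div_comm, mul_assoc]
    gcongr
  have hle : amplitude r n * s ≤ amplitude r (n + k) :=
    le_of_sq_le_sq hratio (amplitude_nonneg hr.le _)
  calc amplitude r n ^ 2 * (1 - k / 2 * (t - 1)) ≤ amplitude r n ^ 2 * s := by gcongr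
    _ = amplitude r n * (amplitude r n * s) := by ring
    _ ≤ _ := by gcongr

/-- The upper bound `1` is the inequality of arithmetic and geometric means, the lower bound
`1 - k² / (2r²)` comes from `amplitude_mul_ge` and the mean of the Poisson distribution. -/
theorem tendsto_tsum_amplitude_mul {k : ℕ} (hk : 1 ≤ k) :
    Tendsto (fun r => ∑' n, amplitude r n * amplitude r (n + k)) atTop (𝓝 1) := by
  have hlow : Tendsto (fun r : ℝ => 1 - (k / 2 * k : ℝ) / r ^ 2) atTop (𝓝 1) := by
    have h := (tendsto_const_nhds (x := (k / 2 * k : ℝ))).div_atTop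
      (tendsto_pow_atTop (α := ℝ) two_ne_zero)
    simpa using h.const_sub 1
  refine tendsto_of_tendsto_of_tendsto_of_le_of_le' hlow tendsto_const_nhds ?_ ?_
  · filter_upwards [eventually_gt_atTop 0] with r hr
    have h1 : HasSum (fun n : ℕ => amplitude r n ^ 2 * (1 - k / 2 * ((n + k) / r ^ 2 - 1)))
        (1 - (k / 2 * k : ℝ) / r ^ 2) := by
      have h := ((hasSum_amplitude_sq r).mul_left (1 - k / 2 * (k / r ^ 2 - 1))).sub
        ((hasSum_mul_amplitude_sq r).mul_left (k / 2 / r ^ 2))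
      convert! h using 1
      · funext n; field_simp; ring
      · field_simp; ring
    exact hasSum_le (fun n => amplitude_mul_ge hr hk n) h1 (summable_amplitude_mul hr.le k).hasSum
  · filter_upwards [eventually_ge_atTop 0] with r hr
    have h := hasSum_amplitude_sq r
    have hk := (summable_nat_add_iff k).2 h.summable
    have hk1 : ∑' n, amplitude r (n + k) ^ 2 ≤ 1 := by
      rw [← h.tsum_eq, ← h.summable.sum_add_tsum_nat_add k]
      exact le_add_of_nonneg_left (Finset.sum_nonneg fun _ _ => sq_nonneg _)
    have := hasSum_le (fun n => ?_) (summable_amplitude_mul hr k).hasSum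
      ((h.add hk.hasSum).div_const 2)
    · linarith
    · linarith [sq_nonneg (amplitude r n - amplitude r (n + k))]

/-! ### Coherent states of large amplitude -/

section Coherent

variable {H : Type*} [NormedAddCommGroup H] [InnerProductSpace ℂ H] [CompleteSpace H]

theorem inner_coherent (b : HilbertBasis ℕ ℂ H) (z : ℂ) (n : ℕ) :
    inner ℂ (b n) (coherent b z) = ((Real.exp (-‖z‖ ^ 2 / 2) : ℝ) : ℂ) *
      (z ^ n / ((Real.sqrt (Nat.factorial n) : ℝ) : ℂ)) := by
  rw [coherent, inner_smul_right]
  congr 1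
  have h := (innerSL ℂ (b n)).hasSum (summable_coherent b z).hasSum
  simp only [innerSL_apply_apply, inner_smul_right, orthonormal_iff_ite.1 b.orthonormal] at h
  refine h.unique ?_
  convert! hasSum_ite_eq n (z ^ n / ((Real.sqrt (Nat.factorial n) : ℝ) : ℂ)) using 2 with m
  by_cases hm : m = n
  · subst hm; simp
  · simp [hm, Ne.symm hm]

theorem norm_inner_coherent (b : HilbertBasis ℕ ℂ H) (z : ℂ) (n : ℕ) :
    ‖inner ℂ (b n) (coherent b z)‖ = amplitude ‖z‖ n := by
  rw [inner_coherent, norm_mul, norm_div, norm_pow, Complex.norm_real, Complex.norm_real,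
    Real.norm_of_nonneg (Real.exp_pos _).le, Real.norm_of_nonneg (Real.sqrt_nonneg _), amplitude]

theorem norm_coherent (b : HilbertBasis ℕ ℂ H) (z : ℂ) : ‖coherent b z‖ = 1 := by
  have h := b.hasSum_inner_mul_inner (coherent b z) (coherent b z)
  have h1 : ∀ n, inner ℂ (coherent b z) (b n) * inner ℂ (b n) (coherent b z) =
      ((amplitude ‖z‖ n ^ 2 : ℝ) : ℂ) := fun n => by
    rw [← norm_inner_coherent b, ← inner_conj_symm, mul_comm, Complex.mul_conj,
      Complex.normSq_eq_norm_sq]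
  simp only [h1] at h
  have h2 := h.unique (Complex.hasSum_ofReal.2 (hasSum_amplitude_sq ‖z‖))
  rw [inner_self_eq_norm_sq_to_K, ← RCLike.ofReal_pow] at h2
  have h3 : ‖coherent b z‖ ^ 2 = 1 := Complex.ofReal_injective h2
  exact (pow_eq_one_iff_of_nonneg (norm_nonneg _) two_ne_zero).1 h3

theorem inner_coherent_polar (b : HilbertBasis ℕ ℂ H) {r : ℝ} (hr : 0 ≤ r) (η : ℝ) (n : ℕ) :
    inner ℂ (b n) (coherent b (r * Complex.exp (Complex.I * η))) =
      amplitude r n * Complex.exp (Complex.I * η) ^ n := by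
  have hz : ‖(r : ℂ) * Complex.exp (Complex.I * η)‖ = r := by
    rw [norm_mul, Complex.norm_real, Real.norm_of_nonneg hr, mul_comm Complex.I,
      Complex.norm_exp_ofReal_mul_I, mul_one]
  rw [inner_coherent, hz, mul_pow, amplitude]
  push_cast
  ring

/-- The `k`-th Fourier coefficient in the coherent state `|r e^{iη}⟩` is `e^{ikη}` times a weighted
mean of the `k`-th diagonal of the phase matrix. -/
theorem IsPhaseMatrix.tendsto_integral_fourier_coherent {b : HilbertBasis ℕ ℂ H}
    {E : OperatorMeasure Phase H} {c : ℕ → ℕ → ℂ} (hc : IsPhaseMatrix b E c) {k : ℕ} (hk : 1 ≤ k)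
    {L : ℂ} (hL : Tendsto (fun n => c n (n + k)) atTop (𝓝 L)) (η : ℝ) :
    Tendsto (fun r : ℝ => ∫ x, fourier (k : ℤ) x
        ∂(E.distribution (coherent b (r * Complex.exp (Complex.I * η))))) atTop
      (𝓝 (Complex.exp (Complex.I * η) ^ k * L)) := by
  have key := (tendsto_tsum_weight_mul (l := atTop)
    (w := fun (r : ℝ) n => amplitude r n * amplitude r (n + k))
    (by
      filter_upwards [eventually_ge_atTop 0] with r hr n
      exact mul_nonneg (amplitude_nonneg hr _) (amplitude_nonneg hr _))
    (by
      filter_upwards [eventually_ge_atTop 0] with r hr using summable_amplitude_mul hr k)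
    (tendsto_tsum_amplitude_mul hk)
    (fun n => by simpa using (tendsto_amplitude n).mul (tendsto_amplitude (n + k)))
    hL).const_mul (Complex.exp (Complex.I * η) ^ k)
  refine key.congr' ?_
  filter_upwards [eventually_ge_atTop 0] with r hr
  obtain ⟨M, hM⟩ := (Metric.isBounded_range_of_tendsto _ hL).exists_norm_le
  have hsum : Summable fun n =>
      ((amplitude r n * amplitude r (n + k) : ℝ) : ℂ) * c n (n + k) := by
    refine Summable.of_norm_bounded ((summable_amplitude_mul hr k).mul_right M) fun n => ?_
    rw [norm_mul, Complex.norm_real, Real.norm_of_nonneg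
      (mul_nonneg (amplitude_nonneg hr _) (amplitude_nonneg hr _))]
    exact mul_le_mul_of_nonneg_left (hM _ ⟨n, rfl⟩)
      (mul_nonneg (amplitude_nonneg hr _) (amplitude_nonneg hr _))
  refine tendsto_nhds_unique
    ((hsum.hasSum.mul_left (Complex.exp (Complex.I * η) ^ k)).tendsto_sum_nat) ?_
  refine (hc.tendsto_integral_fourier_distribution _ k).congr fun N => ?_
  refine Finset.sum_congr rfl fun n _ => ?_
  have hunit : (starRingEnd ℂ) (Complex.exp (Complex.I * η)) * Complex.exp (Complex.I * η) = 1 := by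
    rw [mul_comm, Complex.mul_conj, Complex.normSq_eq_norm_sq, mul_comm Complex.I,
      Complex.norm_exp_ofReal_mul_I]
    simp
  rw [inner_coherent_polar b hr, inner_coherent_polar b hr, map_mul, map_pow, Complex.conj_ofReal]
  have h2 := congrArg (· ^ n) hunit
  simp only [mul_pow, one_pow] at h2
  push_cast
  rw [pow_add]
  linear_combination (amplitude r n * amplitude r (n + k) * Complex.exp (Complex.I * η) ^ k *
    c n (n + k) : ℂ) * h2

end Coherent

/-! ### Weak convergence on the circle -/

theorem fourier_coe_eq_exp (q : ℤ) (t : ℝ) :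
    fourier q (t : Phase) = Complex.exp (Complex.I * q * t) := by
  rw [fourier_coe_apply]
  congr 1
  have : (Real.pi : ℂ) ≠ 0 := by exact_mod_cast Real.pi_ne_zero
  push_cast
  field_simp

theorem integral_fourier_neg (μ : Measure Phase) (q : ℤ) :
    ∫ x, fourier (-q) x ∂μ = (starRingEnd ℂ) (∫ x, fourier q x ∂μ) := by
  rw [← integral_conj]
  exact integral_congr_ae (Eventually.of_forall fun x => fourier_neg)

theorem integrable_continuousMap (μ : Measure Phase) [IsFiniteMeasure μ] (g : C(Phase, ℂ)) :
    Integrable g μ :=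
  Integrable.of_bound (map_continuous g).measurable.aestronglyMeasurable ‖g‖
    (Eventually.of_forall g.norm_coe_le_norm)

/-- Probability measures on the circle converge weakly to a Dirac measure as soon as their Fourier
coefficients of positive index converge: trigonometric polynomials are dense. -/
theorem tendsto_integral_of_tendsto_fourier {J : Type*} {l : Filter J} {μ : J → Measure Phase}
    [∀ j, IsProbabilityMeasure (μ j)] {p : Phase}
    (h : ∀ k : ℕ, 1 ≤ k →
      Tendsto (fun j => ∫ x, fourier (k : ℤ) x ∂(μ j)) l (𝓝 (fourier (k : ℤ) p)))
    (g : C(Phase, ℂ)) : Tendsto (fun j => ∫ x, g x ∂(μ j)) l (𝓝 (g p)) := by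
  have hnat : ∀ k : ℕ, Tendsto (fun j => ∫ x, fourier (k : ℤ) x ∂(μ j)) l
      (𝓝 (fourier (k : ℤ) p)) := by
    intro k
    rcases Nat.eq_zero_or_pos k with rfl | hk
    · simpa using tendsto_const_nhds
    · exact h k hk
  have hint : ∀ q : ℤ, Tendsto (fun j => ∫ x, fourier q x ∂(μ j)) l (𝓝 (fourier q p)) := by
    intro q
    obtain ⟨k, rfl | rfl⟩ := q.eq_nat_or_neg
    · exact hnat k
    · simp only [integral_fourier_neg]
      rw [fourier_neg]
      exact (Complex.continuous_conj.tendsto _).comp (hnat k)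
  have hspan : ∀ f ∈ Submodule.span ℂ (Set.range (@fourier (2 * Real.pi))),
      Tendsto (fun j => ∫ x, f x ∂(μ j)) l (𝓝 (f p)) := by
    intro f hf
    induction hf using Submodule.span_induction with
    | mem x hx => obtain ⟨q, rfl⟩ := hx; exact hint q
    | zero => simpa using tendsto_const_nhds
    | add f₁ f₂ _ _ h₁ h₂ =>
      simp only [ContinuousMap.add_apply]
      refine (h₁.add h₂).congr fun j => ?_
      rw [integral_add (integrable_continuousMap _ f₁) (integrable_continuousMap _ f₂)]
    | smul c f _ hf =>
      simp only [ContinuousMap.smul_apply, integral_smul]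
      exact hf.const_smul c
  have hdense : g ∈ (Submodule.span ℂ (Set.range (@fourier (2 * Real.pi)))).topologicalClosure := by
    rw [span_fourier_closure_eq_top]; trivial
  rw [Metric.tendsto_nhds]
  intro ε hε
  obtain ⟨f, hf, hgf⟩ := Metric.mem_closure_iff.1 hdense (ε / 3) (by positivity)
  rw [dist_eq_norm] at hgf
  filter_upwards [Metric.tendsto_nhds.1 (hspan f hf) (ε / 3) (by positivity)] with j hj
  rw [dist_eq_norm] at hj ⊢
  have h1 : ‖∫ x, g x ∂(μ j) - ∫ x, f x ∂(μ j)‖ ≤ ‖g - f‖ := by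
    rw [← integral_sub (integrable_continuousMap _ g) (integrable_continuousMap _ f)]
    simpa using norm_integral_le_of_norm_le_const (μ := μ j)
      (Eventually.of_forall fun x => (g - f).norm_coe_le_norm x)
  have h2 : ‖f p - g p‖ ≤ ‖g - f‖ := by
    rw [norm_sub_rev]; exact (g - f).norm_coe_le_norm p
  calc ‖∫ x, g x ∂(μ j) - g p‖ = ‖(∫ x, g x ∂(μ j) - ∫ x, f x ∂(μ j)) +
        (∫ x, f x ∂(μ j) - f p) + (f p - g p)‖ := by congr 1; ring
    _ ≤ ‖g - f‖ + ‖∫ x, f x ∂(μ j) - f p‖ + ‖g - f‖ :=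
        (norm_add₃_le).trans (by gcongr)
    _ < ε := by linarith

/-- The portmanteau theorem for a Dirac limit, with complex-valued test functions. -/
theorem tendsto_measureReal_of_tendsto_integral {J : Type*} {l : Filter J} {μ : J → Measure Phase}
    [∀ j, IsProbabilityMeasure (μ j)] {p : Phase}
    (h : ∀ g : C(Phase, ℂ), Tendsto (fun j => ∫ x, g x ∂(μ j)) l (𝓝 (g p)))
    {X : Set Phase} (hX : p ∉ frontier X) :
    Tendsto (fun j => (μ j).real X) l (𝓝 ((Measure.dirac p : Measure Phase).real X)) := by
  let ν : J → ProbabilityMeasure Phase := fun j => ⟨μ j, inferInstance⟩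
  let δ : ProbabilityMeasure Phase := ⟨Measure.dirac p, inferInstance⟩
  have hlim : Tendsto ν l (𝓝 δ) := by
    rw [ProbabilityMeasure.tendsto_iff_forall_integral_tendsto]
    intro f
    have h1 := (Complex.continuous_re.tendsto _).comp
      (h ⟨fun x => (f x : ℂ), Complex.continuous_ofReal.comp f.continuous⟩)
    change Tendsto (fun j => ∫ x, f x ∂(μ j)) l (𝓝 (∫ x, f x ∂(Measure.dirac p)))
    rw [integral_dirac]
    refine h1.congr fun j => ?_
    have h2 : ∫ x, (f x : ℂ) ∂(μ j) = ((∫ x, f x ∂(μ j) : ℝ) : ℂ) := integral_ofReal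
    exact (congrArg Complex.re h2).trans (Complex.ofReal_re _)
  have hfr : (δ : Measure Phase) (frontier X) = 0 := by
    change Measure.dirac p (frontier X) = 0
    rw [Measure.dirac_apply' _ isClosed_frontier.measurableSet, Set.indicator_of_notMem hX]
  exact (ENNReal.tendsto_toReal (measure_ne_top _ _)).comp
    (ProbabilityMeasure.tendsto_measure_of_null_frontier_of_tendsto' hlim hfr)

/-! ### The phase difference -/

section Difference

variable {H : Type*} [NormedAddCommGroup H] [InnerProductSpace ℂ H] {b : HilbertBasis ℕ ℂ H}

theorem inner_shift_phase [CompleteSpace H] {E : OperatorMeasure Phase H}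
    (hE : IsPhaseObservable b E) {X : Set Phase} (hX : MeasurableSet X) (θ : Phase) (n m : ℕ) :
    inner ℂ (b n) (E (shift X θ) (b m)) =
      fourier ((n : ℤ) - (m : ℤ)) θ * inner ℂ (b n) (E X (b m)) := by
  induction θ using QuotientAddGroup.induction_on with
  | H t => exact inner_shift hE hX t n m

/-- The probability of a translated set depends continuously on the translation, in every state:
it is a uniform limit of trigonometric polynomials. -/
theorem continuous_distribution_shift [CompleteSpace H] {E : OperatorMeasure Phase H}
    (hE : IsPhaseObservable b E) {X : Set Phase} (hX : MeasurableSet X) (ψ : H) :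
    Continuous fun θ => (E.distribution ψ).real (shift X θ) := by
  let ψN : ℕ → H := fun N => ∑ i ∈ Finset.range N, inner ℂ (b i) ψ • b i
  have hψN : Tendsto ψN atTop (𝓝 ψ) := by
    simpa only [b.repr_apply_apply] using (b.hasSum_repr ψ).tendsto_sum_nat
  have hcont : ∀ N, Continuous fun θ => (E.distribution (ψN N)).real (shift X θ) := by
    intro N
    have h : ∀ θ, (E.distribution (ψN N)).real (shift X θ) =
        (∑ i ∈ Finset.range N, ∑ j ∈ Finset.range N, (starRingEnd ℂ) (inner ℂ (b i) ψ) *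
          (inner ℂ (b j) ψ * (fourier ((i : ℤ) - (j : ℤ)) θ * inner ℂ (b i) (E X (b j))))).re := by
      intro θ
      rw [← Complex.ofReal_re ((E.distribution (ψN N)).real _),
        E.distribution_real _ (measurableSet_shift hX θ)]
      congr 1
      simp only [ψN, sum_inner, map_sum, inner_sum, map_smul, inner_smul_left, inner_smul_right,
        inner_shift_phase hE hX]
      simp only [Finset.mul_sum]
      rw [Finset.sum_comm]
      exact Finset.sum_congr rfl fun i _ => Finset.sum_congr rfl fun j _ => by ring
    simp only [h]
    refine Complex.continuous_re.comp (continuous_finsetSum _ fun i _ =>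
      continuous_finsetSum _ fun j _ => continuous_const.mul
        (continuous_const.mul ((map_continuous (fourier _)).mul continuous_const)))
  have hunif : TendstoUniformly (fun N θ => (E.distribution (ψN N)).real (shift X θ))
      (fun θ => (E.distribution ψ).real (shift X θ)) atTop := by
    have hb : Tendsto (fun N => ‖ψN N - ψ‖ * (‖ψN N‖ + ‖ψ‖)) atTop (𝓝 0) := by
      have h1 : Tendsto (fun N => ‖ψN N - ψ‖) atTop (𝓝 0) := by
        simpa using (hψN.sub_const ψ).norm
      simpa using h1.mul (hψN.norm.add_const ‖ψ‖)
    rw [Metric.tendstoUniformly_iff]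
    intro ε hε
    filter_upwards [hb.eventually_lt_const hε] with N hN θ
    rw [dist_comm, Real.dist_eq]
    exact (E.abs_distribution_real_sub_le _ _ (measurableSet_shift hX θ)).trans_lt hN
  exact hunif.continuous (Eventually.frequently (Eventually.of_forall hcont))

variable {E₁ E₂ : OperatorMeasure Phase H}
  {Et : OperatorMeasure (Phase × Phase) (TwoMode H)}

theorem IsProduct.distribution_difference_elem (h : IsProduct E₁ E₂ Et) (φ ψ : H) :
    (difference Et).distribution (elem φ ψ) =
      ((E₁.distribution φ).prod (E₂.distribution ψ)).map (fun p => p.1 - p.2) := by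
  rw [difference, OperatorMeasure.distribution_map, h.distribution_elem]

theorem IsProduct.distribution_difference_real (h : IsProduct E₁ E₂ Et) (φ ψ : H)
    {X : Set Phase} (hX : MeasurableSet X) :
    ((difference Et).distribution (elem φ ψ)).real X =
      ∫ y, (E₁.distribution φ).real (shift X y) ∂(E₂.distribution ψ) := by
  have hf : Measurable fun p : Phase × Phase => p.1 - p.2 := measurable_fst.sub measurable_snd
  have hpre : ∀ y : Phase, (fun x => (x, y)) ⁻¹' ((fun p : Phase × Phase => p.1 - p.2) ⁻¹' X) =
      shift X y := fun y => by
    rw [shift, Set.image_add_right]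
    ext x
    simp [sub_eq_add_neg]
  have hmeas := measurable_measure_prodMk_right (μ := E₁.distribution φ) (hf hX)
  simp only [hpre] at hmeas
  rw [h.distribution_difference_elem, Measure.real, Measure.map_apply hf hX,
    Measure.prod_apply_symm (hf hX)]
  simp only [hpre]
  exact (integral_toReal hmeas.aemeasurable
    (Eventually.of_forall fun y => measure_lt_top _ _)).symm

theorem IsProduct.integral_fourier_difference (h : IsProduct E₁ E₂ Et) (φ ψ : H) (k : ℤ) :
    ∫ x, fourier k x ∂((difference Et).distribution (elem φ ψ)) =
      (∫ x, fourier k x ∂(E₁.distribution φ)) *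
        (starRingEnd ℂ) (∫ x, fourier k x ∂(E₂.distribution ψ)) := by
  have hf : Measurable fun p : Phase × Phase => p.1 - p.2 := measurable_fst.sub measurable_snd
  rw [h.distribution_difference_elem, integral_map hf.aemeasurable
    (map_continuous (fourier k)).measurable.aestronglyMeasurable, ← integral_fourier_neg,
    ← integral_prod_mul]
  refine integral_congr_ae (Eventually.of_forall fun p => ?_)
  simp [fourier_apply, sub_eq_add_neg, AddCircle.toCircle_add]

end Difference

section ClassicalLimit

variable {H : Type*} [NormedAddCommGroup H] [InnerProductSpace ℂ H] [CompleteSpace H]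
  {b : HilbertBasis ℕ ℂ H}

/-- In the state `|r e^{iη}⟩`, as `r → ∞`, the distribution has asymptotically the Fourier
coefficients of the Dirac measure at `η - α`. -/
theorem IsPhaseMatrix.tendsto_integral_fourier_classical {E : OperatorMeasure Phase H}
    {c : ℕ → ℕ → ℂ} (hc : IsPhaseMatrix b E c) {α : ℝ}
    (hα : ∀ k : ℕ, 1 ≤ k → Tendsto (fun n : ℕ => c n (n + k)) atTop
      (𝓝 (Complex.exp (-(Complex.I * k * α))))) (η : ℝ) {k : ℕ} (hk : 1 ≤ k) :
    Tendsto (fun r : ℝ => ∫ x, fourier (k : ℤ) x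
        ∂(E.distribution (coherent b (r * Complex.exp (Complex.I * η))))) atTop
      (𝓝 (fourier (k : ℤ) ((η - α : ℝ) : Phase))) := by
  have h := hc.tendsto_integral_fourier_coherent hk (hα k hk) η
  convert! h using 2
  rw [fourier_coe_eq_exp, ← Complex.exp_nat_mul, ← Complex.exp_add]
  congr 1
  push_cast; ring

theorem norm_coherent₂ (b : HilbertBasis ℕ ℂ H) (z₁ z₂ : ℂ) : ‖coherent₂ b z₁ z₂‖ = 1 := by
  rw [coherent₂, norm_elem, norm_coherent, norm_coherent, one_mul]

end ClassicalLimit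

end QuantumPhase

end

theorem mainTheorem6 {H : Type*} [NormedAddCommGroup H] [InnerProductSpace ℂ H] [CompleteSpace H]
    (b : HilbertBasis ℕ ℂ H) (E₁ E₂ : OperatorMeasure Phase H)
    (hE₁ : IsPhaseObservable b E₁) (hE₂ : IsPhaseObservable b E₂) :
    -- there is exactly one operator measure `Et` with `Et(X × Y) = E₁(X) ⊗ E₂(Y)`
    (∃! Et : OperatorMeasure (Phase × Phase) (TwoMode H), IsProduct E₁ E₂ Et) ∧
    ∀ Et : OperatorMeasure (Phase × Phase) (TwoMode H), IsProduct E₁ E₂ Et →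
    ∀ α : ℝ,
      (∀ k : ℕ, 1 ≤ k → Tendsto (fun n : ℕ => phaseMatrix b E₂ hE₂ n (n + k)) atTop
        (𝓝 (Complex.exp (-(Complex.I * k * α))))) →
      -- the classical limit of the second mode, with `z₂ = r e^{iη}`
      (∀ X : Set Phase, MeasurableSet X → ∀ (z₁ : ℂ) (η : ℝ),
        Tendsto (fun r : ℝ =>
            inner ℂ (coherent₂ b z₁ (r * Complex.exp (Complex.I * η)))
              (difference Et X (coherent₂ b z₁ (r * Complex.exp (Complex.I * η)))))
          atTop
          (𝓝 (inner ℂ (coherent b z₁)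
            (E₁ (shift X ((η - α : ℝ) : Phase)) (coherent b z₁))))) ∧
      -- the classical limit of both modes, with `z₁ = r₁ e^{iη₁}` and `z₂ = r₂ e^{iη₂}`
      (∀ α' : ℝ,
        (∀ k : ℕ, 1 ≤ k → Tendsto (fun n : ℕ => phaseMatrix b E₁ hE₁ n (n + k)) atTop
          (𝓝 (Complex.exp (-(Complex.I * k * α'))))) →
        ∀ η₁ η₂ : ℝ,
          -- weak convergence of the distributions to the Dirac measure
          (∀ g : C(Phase, ℂ),
            Tendsto (fun r : ℝ × ℝ =>
                ∫ x, g x ∂((difference Et).distribution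
                  (coherent₂ b (r.1 * Complex.exp (Complex.I * η₁))
                    (r.2 * Complex.exp (Complex.I * η₂)))))
              (atTop ×ˢ atTop)
              (𝓝 (∫ x, g x ∂(Measure.dirac ((η₁ - η₂ - α' + α : ℝ) : Phase) : Measure Phase)))) ∧
          -- convergence on every Borel set whose boundary does not contain the limit point
          (∀ X : Set Phase, MeasurableSet X → ((η₁ - η₂ - α' + α : ℝ) : Phase) ∉ frontier X →
            Tendsto (fun r : ℝ × ℝ =>
                inner ℂ
                  (coherent₂ b (r.1 * Complex.exp (Complex.I * η₁))
                    (r.2 * Complex.exp (Complex.I * η₂)))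
                  (difference Et X
                    (coherent₂ b (r.1 * Complex.exp (Complex.I * η₁))
                      (r.2 * Complex.exp (Complex.I * η₂)))))
              (atTop ×ˢ atTop)
              (𝓝 ((Measure.dirac ((η₁ - η₂ - α' + α : ℝ) : Phase) : Measure Phase).real X : ℂ)))) := by
  have hc₁ := phaseMatrix_spec b E₁ hE₁
  have hc₂ := phaseMatrix_spec b E₂ hE₂
  obtain ⟨Et₀, hEt₀⟩ := exists_isProduct hc₁ hc₂
  refine ⟨⟨Et₀, hEt₀, fun Et' h' => h'.unique hEt₀⟩, fun Et hEt α hα => ⟨?_, ?_⟩⟩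
  · intro X hX z₁ η
    have hprob : ∀ r : ℝ, IsProbabilityMeasure
        (E₂.distribution (coherent b (r * Complex.exp (Complex.I * η)))) := fun r =>
      E₂.isProbabilityMeasure_distribution (norm_coherent b _)
    let g : C(Phase, ℂ) :=
      ⟨fun θ => ((E₁.distribution (coherent b z₁)).real (shift X θ) : ℂ),
        Complex.continuous_ofReal.comp (continuous_distribution_shift hE₁ hX _)⟩
    have h := tendsto_integral_of_tendsto_fourier
      (fun k hk => hc₂.tendsto_integral_fourier_classical hα η hk) g
    rw [← OperatorMeasure.distribution_real E₁ _ (measurableSet_shift hX _)]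
    refine h.congr fun r => ?_
    rw [← OperatorMeasure.distribution_real _ _ hX, coherent₂,
      hEt.distribution_difference_real _ _ hX]
    exact integral_ofReal
  · intro α' hα' η₁ η₂
    have hprob : ∀ r : ℝ × ℝ, IsProbabilityMeasure ((difference Et).distribution
        (coherent₂ b (r.1 * Complex.exp (Complex.I * η₁))
          (r.2 * Complex.exp (Complex.I * η₂)))) := fun r =>
      OperatorMeasure.isProbabilityMeasure_distribution _ (norm_coherent₂ b _ _)
    have hfourier : ∀ k : ℕ, 1 ≤ k → Tendsto (fun r : ℝ × ℝ =>
        ∫ x, fourier (k : ℤ) x ∂((difference Et).distribution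
          (coherent₂ b (r.1 * Complex.exp (Complex.I * η₁))
            (r.2 * Complex.exp (Complex.I * η₂))))) (atTop ×ˢ atTop)
        (𝓝 (fourier (k : ℤ) ((η₁ - η₂ - α' + α : ℝ) : Phase))) := by
      intro k hk
      have h₁ := (hc₁.tendsto_integral_fourier_classical hα' η₁ hk).comp
        (tendsto_fst (f := (atTop : Filter ℝ)) (g := (atTop : Filter ℝ)))
      have h₂ := (Complex.continuous_conj.tendsto _).comp
        ((hc₂.tendsto_integral_fourier_classical hα η₂ hk).comp
          (tendsto_snd (f := (atTop : Filter ℝ)) (g := (atTop : Filter ℝ))))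
      have h := h₁.mul h₂
      have hp : fourier (k : ℤ) ((η₁ - η₂ - α' + α : ℝ) : Phase) =
          fourier (k : ℤ) ((η₁ - α' : ℝ) : Phase) *
            (starRingEnd ℂ) (fourier (k : ℤ) ((η₂ - α : ℝ) : Phase)) := by
        rw [← fourier_neg, fourier_coe_eq_exp, fourier_coe_eq_exp, fourier_coe_eq_exp,
          ← Complex.exp_add]
        congr 1
        push_cast; ring
      rw [hp]
      refine h.congr fun r => ?_
      rw [coherent₂, hEt.integral_fourier_difference]
      rfl
    have hweak := tendsto_integral_of_tendsto_fourier hfourier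
    refine ⟨fun g => ?_, fun X hX hp => ?_⟩
    · rw [integral_dirac]
      exact hweak g
    · have h := (Complex.continuous_ofReal.tendsto _).comp
        (tendsto_measureReal_of_tendsto_integral hweak hp)
      refine h.congr fun r => ?_
      exact OperatorMeasure.distribution_real _ _ hX
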